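/- **Setting.** Let $\mathcal T,\mathcal X,\mathcal L$ be finite sets of threads, memory locations and locks, and let $\Sigma$ be the set of labels $\langle t,o\rangle$ with $t\in\mathcal T$ and $o\in\{\mathtt r(x),\mathtt w(x)\mid x\in\mathcal X\}\cup\{\mathtt{acq}(\ell),\mathtt{rel}(\ell)\mid \ell\in\mathcal L\}$. A *run* is a word over $\Sigma$; its *events* are its labelled positions. A run is *well-formed* if for each $x$ its projection to $x$ has the form $(\mathtt w(x)\,\mathtt r(x)^*)^*$, and for each $\ell$ critical sections on $\ell$ do not overlap: its projection to $\ell$ is a sequence of blocks $\langle t,\mathtt{acq}(\ell)\rangle\langle t,\mathtt{rel}(\ell)\rangle$, possibly followed by one open acquire. The program order $\mathsf{po}_\sigma$ relates $e$ to $f$ if they have the same thread and $e=f$ or $e$ precedes $f$; the reads-from relation $\mathsf{rf}_\sigma$ relates each read to the last preceding write to its location. Let $\sigma$ be a well-formed run. A *correct reordering* of $\sigma$ is a well-formed sequence $\rho$ of distinct events of $\sigma$ such that $\rho|_t$ is a prefix of $\sigma|_t$ for each thread $t$ and $\mathsf{rf}_\rho\subseteq\mathsf{rf}_\sigma$. It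 is a *SeqP-prefix* if its events occur in the same order as in $\sigma$. A subsequence $\tau$ of $\sigma$ is *enabled after* $\rho$ if $\rho$ and $\tau$ share no event, the events of $\rho\tau$ are closed under $\mathsf{po}_\sigma$-predecessors, $\rho\tau$ is well-formed, and every read of $\tau$ that reads from a different write in $\rho\tau$ than in $\sigma$ is the last event of its thread in $\rho\tau$. A *SeqP-suffix* of a SeqP-prefix $\rho$ is a subsequence $\tau$ enabled after $\rho$; it is *maximal* if it is not a subsequence of another SeqP-suffix of $\rho$. A *grain* of $\tau$ is a contiguous subword of $\tau$. Labels $a,b$ are *independent* if their threads differ and, in case they access the same object, both are reads. Two events *conflict* if they access the same memory location and at least one is a write. A pair $(e_1,e_2)$ of conflicting events of different threads is an *$\mathcal M$-race* in a sequence $s$ of events if $e_1,e_2$ are consecutive in some sequence obtained from $s$ by repeatedly swapping consecutive independent events. A pair $(e_1,e_2)$ is a *GrPrefix-race* (granular prefix $\mathcal M$-race) of $\sigma$ if there are a SeqP-prefix $\rho$, two (not necessarily distinct) maximal SeqP-suffixes $\tau_1,\tau_2$ of $\rho$, a grain $g_1\ni e_1$ of $\tau_1$ and a grain $g_2\ni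 e_2$ of $\tau_2$ such that $g_1g_2$ is enabled after $\rho$ (in particular it is a subsequence of $\sigma$) and $(e_1,e_2)$ is an $\mathcal M$-race in $g_1g_2$; then $W=(\rho,g_1,g_2,e_1,e_2)$ is a *witness*. Let $L_{\mathrm{GrPrefix}}\subseteq\Sigma^*$ be the set of well-formed runs that have a GrPrefix-race. For a witness $W$ of $\sigma$ and $0\le k\le|\sigma|$, the *summary* of $W$ after the first $k$ events is the tuple $(e_1,p_\rho,p_{g_1},p_{g_2},\mathsf{AftSet}_{e_1},\mathsf{phase})$, where, looking only at events among the first $k$: - the first entry is the label of $e_1$, if $e_1$ has been read, and undefined otherwise; - $p_\rho$ consists of the set of threads with an event outside $\rho$, the set of locks with an acquire in $\rho$ whose matching release has been read and is not in $\rho$, and the set of locations whose latest write is not in $\rho$; - $p_{g}$ consists of the set of threads with an event in $g$, the set of locks with an acquire in $g$, the set of locks with a release in $g$ whose matching acquire is not in $g$, the set of locations written in $g$, and the set of locations with a read in $g$ whose $\mathsf{rf}_\sigma$-write is not in $g$; - $\mathsf{AftSet}_{e_1}$ consists of the sets of threads, read locations, written locations and locks of the events in the smallest set that contains $e_1$ and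 each event of $g_1g_2$ that is preceded in $g_1g_2$ by a member of the set from which it is not independent; - $\mathsf{phase}$ is *Inside$_2$* if an event of $g_2$ has been read; otherwise *Inside$_1$* if some but not all events of $g_1$ have been read, *Between* if all of them have been read, and *Before* if none has. **Theorem.** 1. There is a nondeterministic finite automaton $\mathcal A_{\mathrm{GrPrefix}}$ over $\Sigma$ with $L(\mathcal A_{\mathrm{GrPrefix}})=L_{\mathrm{GrPrefix}}$. Each of its states consists of a tuple of the above kind and an additional component from a finite set, in such a way that: for every well-formed $\sigma$ and every witness $W$ of $\sigma$ there is an accepting run $q_0,\dots,q_{|\sigma|}$ of the automaton on $\sigma$ in which the tuple of $q_k$ is, for each $k$, the summary of $W$ after the first $k$ events; and for every accepting run on a word $\sigma$ there is a witness $W$ of $\sigma$ with this property. 2. There is a deterministic one-pass streaming program (fetch the next letter and branch, test a bit, write a bit, halt with an answer) with constantly many program lines and constantly many bits of memory, depending only on $\mathcal T,\mathcal X,\mathcal L$, and a constant $c$ such that on every input $\sigma\in\Sigma^*$ the program halts within $c\,(|\sigma|+1)$ elementary steps and correctly answers whether $\sigma\in L_{\mathrm{GrPrefix}}$. -/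

import Mathlib

open scoped Computability

namespace RacePrediction

/-! ### Labels, well-formed runs -/

/-- Operations on shared memory locations `X` and on locks `L`. -/
inductive Action (X L : Type*) where
  | read (x : X)
  | write (x : X)
  | acq (l : L)
  | rel (l : L)

/-- The object (memory location or lock) accessed by an operation. -/
def Action.obj {X L : Type*} : Action X L → X ⊕ L
  | .read x => .inl x
  | .write x => .inl x
  | .acq l => .inr l
  | .rel l => .inr l

/-- Event labels: the alphabet `Σ` of threads performing operations. -/
structure Label (T X L : Type*) where
  thread : T
  act : Action X L

variable {T X L : Type*}

open Classical in
/-- The projection of a word to the labels that access a given object. -/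
noncomputable def projObj (σ : List (Label T X L)) (d : X ⊕ L) : List (Label T X L) :=
  σ.filter (fun a => a.act.obj = d)

/-- The language of one-letter words consisting of an event `⟨t, o⟩` of any thread `t`. -/
def opLang (o : Action X L) : Language (Label T X L) := {u | ∃ t : T, u = [⟨t, o⟩]}

/-- The language of complete critical sections `⟨t, acq l⟩ ⟨t, rel l⟩` of any thread `t`. -/
def critLang (l : L) : Language (Label T X L) :=
  {u | ∃ t : T, u = [⟨t, .acq l⟩, ⟨t, .rel l⟩]}

/-- Well-formedness: for each location `x` the projection to `x` is in `(w(x) r(x)*)*`, and for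
each lock `l` the critical sections on `l` do not overlap, i.e. the projection to `l` is a sequence
of blocks `⟨t, acq l⟩ ⟨t, rel l⟩`, possibly followed by one open acquire. -/
def WellFormed (σ : List (Label T X L)) : Prop :=
  (∀ x : X, projObj σ (.inl x) ∈ (opLang (.write x) * (opLang (.read x))∗)∗) ∧
  (∀ l : L, projObj σ (.inr l) ∈ (critLang l)∗ * (opLang (.acq l) + 1))

/-! ### Events

The events of a run `σ` are its positions, `Fin σ.length` (the position is the unique identifier,
`σ.get e` the label). Sequences of events of `σ` are duplicate-free lists of positions; `σ` itself is
the sequence `List.finRange σ.length`, and its order is the order of `Fin σ.length`. -/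

/-- `e` occurs before `f` in the sequence `s` of pairwise distinct events. -/
def Before {E : Type*} (s : List E) (e f : E) : Prop := [e, f].Sublist s

/-- The reads-from relation of the event sequence `s`. -/
def ReadsFrom {E : Type*} (lab : E → Label T X L) (s : List E) (w r : E) : Prop :=
  ∃ x : X, (lab w).act = .write x ∧ (lab r).act = .read x ∧ Before s w r ∧
    ∀ w' ∈ s, w' ≠ w → (lab w').act = .write x → Before s w' w ∨ Before s r w'

/-- The reads-from relation of the whole run `σ`. -/
def RunReadsFrom (σ : List (Label T X L)) (w r : Fin σ.length) : Prop :=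
  ReadsFrom σ.get (List.finRange σ.length) w r

/-- Program order (a reflexive partial order). -/
def ProgOrder (σ : List (Label T X L)) (e f : Fin σ.length) : Prop :=
  (σ.get e).thread = (σ.get f).thread ∧ e ≤ f

open Classical in
/-- The projection of an event sequence to a thread. -/
noncomputable def projThread (σ : List (Label T X L)) (s : List (Fin σ.length)) (t : T) :
    List (Fin σ.length) :=
  s.filter (fun e => (σ.get e).thread = t)

/-- `ρ` is a correct reordering of `σ`. -/
def CorrectReordering (σ : List (Label T X L)) (ρ : List (Fin σ.length)) : Prop :=
  ρ.Nodup ∧ WellFormed (ρ.map σ.get) ∧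
  (∀ t : T, projThread σ ρ t <+: projThread σ (List.finRange σ.length) t) ∧
  (∀ w r, ReadsFrom σ.get ρ w r → RunReadsFrom σ w r)

/-- `ρ` is a sequential-order-preserving prefix of `σ`. -/
def SeqPPrefix (σ : List (Label T X L)) (ρ : List (Fin σ.length)) : Prop :=
  CorrectReordering σ ρ ∧ ∀ e ∈ ρ, ∀ f ∈ ρ, (Before ρ e f ↔ e < f)

/-- The subsequence `τ` of `σ` is enabled after `ρ`. -/
def EnabledAfter (σ : List (Label T X L)) (ρ τ : List (Fin σ.length)) : Prop :=
  τ.Sublist (List.finRange σ.length) ∧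
  (∀ e ∈ ρ, e ∉ τ) ∧
  (∀ e ∈ ρ ++ τ, ∀ f, ProgOrder σ f e → f ∈ ρ ++ τ) ∧
  WellFormed ((ρ ++ τ).map σ.get) ∧
  (∀ e ∈ τ, ∀ x : X, (σ.get e).act = .read x →
    {w | ReadsFrom σ.get (ρ ++ τ) w e} ≠ {w | RunReadsFrom σ w e} →
    ∀ f ∈ ρ ++ τ, (σ.get f).thread = (σ.get e).thread → ProgOrder σ f e)

/-- `τ` is a suffix of the sequential-order-preserving prefix `ρ`: it is enabled after `ρ` and
its events appear in the same order as in `σ`. -/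
def SeqPSuffix (σ : List (Label T X L)) (ρ τ : List (Fin σ.length)) : Prop :=
  EnabledAfter σ ρ τ ∧ ∀ e ∈ τ, ∀ f ∈ τ, (Before τ e f ↔ e < f)

/-- `τ` is a maximal suffix of `ρ`. -/
def MaximalSeqPSuffix (σ : List (Label T X L)) (ρ τ : List (Fin σ.length)) : Prop :=
  SeqPSuffix σ ρ τ ∧ ∀ τ', SeqPSuffix σ ρ τ' → τ.Sublist τ' → τ' = τ

/-! ### Event-based commutativity -/

/-- The (most permissive sound) independence relation on labels. -/
def Indep (a b : Label T X L) : Prop :=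
  a.thread ≠ b.thread ∧
    (a.act.obj = b.act.obj → ∃ x : X, a.act = .read x ∧ b.act = .read x)

/-- Trace (Mazurkiewicz) equivalence: the smallest equivalence that allows swapping of consecutive
independent events. -/
def MazEquiv {E : Type*} (lab : E → Label T X L) : List E → List E → Prop :=
  Relation.EqvGen fun s s' => ∃ u v a b, Indep (lab a) (lab b) ∧
    s = u ++ a :: b :: v ∧ s' = u ++ b :: a :: v

/-- Two labels conflict: same memory location, at least one is a write. -/
def Conflict (a b : Label T X L) : Prop :=
  ∃ x : X, a.act.obj = .inl x ∧ b.act.obj = .inl x ∧ (a.act = .write x ∨ b.act = .write x)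

/-- `(e₁, e₂)` is a Mazurkiewicz race in the event sequence `s`: conflicting events of different
threads that are consecutive in some sequence equivalent to `s`. -/
def MRace {E : Type*} (lab : E → Label T X L) (s : List E) (e₁ e₂ : E) : Prop :=
  Conflict (lab e₁) (lab e₂) ∧ (lab e₁).thread ≠ (lab e₂).thread ∧
  ∃ s', MazEquiv lab s s' ∧ ∃ u v, s' = u ++ e₁ :: e₂ :: v ∨ s' = u ++ e₂ :: e₁ :: v

/-! ### Granular prefix races -/

/-- A choice of prefix, grains and a pair of events in a run with `n` events. -/
structure Guess (n : ℕ) where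
  pre : List (Fin n)
  g₁ : List (Fin n)
  g₂ : List (Fin n)
  e₁ : Fin n
  e₂ : Fin n

/-- The guess witnesses a granular prefix Mazurkiewicz race of `σ`. Grains of `τ` are contiguous
subwords of `τ`. -/
def IsWitness (σ : List (Label T X L)) (W : Guess σ.length) : Prop :=
  SeqPPrefix σ W.pre ∧
  (∃ τ₁ τ₂, MaximalSeqPSuffix σ W.pre τ₁ ∧ MaximalSeqPSuffix σ W.pre τ₂ ∧
    W.g₁ <:+: τ₁ ∧ W.g₂ <:+: τ₂) ∧
  W.e₁ ∈ W.g₁ ∧ W.e₂ ∈ W.g₂ ∧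
  EnabledAfter σ W.pre (W.g₁ ++ W.g₂) ∧
  MRace σ.get (W.g₁ ++ W.g₂) W.e₁ W.e₂

/-- `(e₁, e₂)` is a granular prefix Mazurkiewicz race of `σ`. -/
def GrPrefixRace (σ : List (Label T X L)) (e₁ e₂ : Fin σ.length) : Prop :=
  ∃ W : Guess σ.length, W.e₁ = e₁ ∧ W.e₂ = e₂ ∧ IsWitness σ W

/-- The language of (well-formed) runs that have a granular prefix Mazurkiewicz race. -/
def grPrefixLang (T X L : Type*) : Language (Label T X L) :=
  {σ | WellFormed σ ∧ ∃ e₁ e₂, GrPrefixRace σ e₁ e₂}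

/-! ### State summaries -/

/-- Summary of the guessed prefix. -/
structure PrefixSummary (T X L : Type*) where
  exclThreads : Set T
  openLcks : Set L
  exclLastWrs : Set X

/-- Summary of a guessed grain. -/
structure GrainSummary (T X L : Type*) where
  inclThreads : Set T
  inclAcqs : Set L
  orphanRels : Set L
  inclWrs : Set X
  orphanRds : Set X

/-- The set of dependent threads, read locations, written locations and locks. -/
structure DepSet (T X L : Type*) where
  threads : Set T
  reads : Set X
  writes : Set X
  locks : Set L

inductive Phase where
  | before
  | inside₁
  | between
  | inside₂

/-- `(e₁, p_ρ, p_{g₁}, p_{g₂}, AftSet_{e₁}, phase)`; the first component is the label of the guessed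
`e₁`, once it has been read. -/
structure GrState (T X L : Type*) where
  e₁ : Option (Label T X L)
  pre : PrefixSummary T X L
  g₁ : GrainSummary T X L
  g₂ : GrainSummary T X L
  aft : DepSet T X L
  phase : Phase

/-- `r` is the release that matches the acquire `a` of lock `l` in `σ`. -/
def Matching (σ : List (Label T X L)) (l : L) (a r : Fin σ.length) : Prop :=
  (σ.get a).act = .acq l ∧ (σ.get r).act = .rel l ∧
  (σ.get a).thread = (σ.get r).thread ∧ a < r ∧
  ∀ f, a < f → f < r → (σ.get f).act.obj ≠ .inr l

/-- Summary of `ρ` after the first `k` events of `σ` have been read: threads with an event excluded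
from `ρ`, locks with an acquire included in `ρ` whose release is excluded, and locations whose latest
write is excluded. -/
def prefixSummary (σ : List (Label T X L)) (ρ : List (Fin σ.length)) (k : ℕ) :
    PrefixSummary T X L where
  exclThreads := {t | ∃ e : Fin σ.length, e.val < k ∧ e ∉ ρ ∧ (σ.get e).thread = t}
  openLcks := {l | ∃ a r : Fin σ.length, r.val < k ∧ Matching σ l a r ∧ a ∈ ρ ∧ r ∉ ρ}
  exclLastWrs := {x | ∃ w : Fin σ.length, w.val < k ∧ (σ.get w).act = .write x ∧ w ∉ ρ ∧
    ∀ w' : Fin σ.length, w'.val < k → (σ.get w').act = .write x → w' ≤ w}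

/-- Summary of the grain `g` after the first `k` events of `σ` have been read: threads with an event
in `g`, locks with an acquire in `g`, locks with a release in `g` whose acquire is not in `g`,
locations written in `g`, and locations with a read in `g` whose corresponding write is not in `g`. -/
def grainSummary (σ : List (Label T X L)) (g : List (Fin σ.length)) (k : ℕ) :
    GrainSummary T X L where
  inclThreads := {t | ∃ e ∈ g, e.val < k ∧ (σ.get e).thread = t}
  inclAcqs := {l | ∃ e ∈ g, e.val < k ∧ (σ.get e).act = .acq l}
  orphanRels := {l | ∃ r ∈ g, r.val < k ∧ (σ.get r).act = .rel l ∧ ¬ ∃ a ∈ g, Matching σ l a r}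
  inclWrs := {x | ∃ e ∈ g, e.val < k ∧ (σ.get e).act = .write x}
  orphanRds := {x | ∃ r ∈ g, r.val < k ∧ (σ.get r).act = .read x ∧ ¬ ∃ w ∈ g, RunReadsFrom σ w r}

/-- The smallest set of events of `s` that contains `e₁` and every later event that depends on one of
its members. -/
inductive AftEvent {E : Type*} (lab : E → Label T X L) (s : List E) (e₁ : E) : E → Prop where
  | base : AftEvent lab s e₁ e₁
  | step {f e : E} : AftEvent lab s e₁ f → Before s f e → ¬ Indep (lab f) (lab e) →
      AftEvent lab s e₁ e

/-- The summary of the events among the first `k` events of `σ` that depend on `e₁` in `s`. -/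
def depSet (σ : List (Label T X L)) (s : List (Fin σ.length)) (e₁ : Fin σ.length) (k : ℕ) :
    DepSet T X L where
  threads := {t | ∃ e, AftEvent σ.get s e₁ e ∧ e.val < k ∧ (σ.get e).thread = t}
  reads := {x | ∃ e, AftEvent σ.get s e₁ e ∧ e.val < k ∧ (σ.get e).act = .read x}
  writes := {x | ∃ e, AftEvent σ.get s e₁ e ∧ e.val < k ∧ (σ.get e).act = .write x}
  locks := {l | ∃ e, AftEvent σ.get s e₁ e ∧ e.val < k ∧ (σ.get e).act.obj = .inr l}

open Classical in
/-- The phase after the first `k` events: no event of `g₁` yet; inside `g₁`; `g₁` complete and no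
event of `g₂` yet; from the first event of `g₂` on. -/
noncomputable def phaseAt {n : ℕ} (W : Guess n) (k : ℕ) : Phase :=
  if ∃ e ∈ W.g₂, e.val < k then .inside₂
  else if ∃ e ∈ W.g₁, e.val < k then
    if ∃ e ∈ W.g₁, k ≤ e.val then .inside₁ else .between
  else .before

/-- The state tuple that summarizes the guess `W` after the first `k` events of `σ`. -/
noncomputable def summaryAt (σ : List (Label T X L)) (W : Guess σ.length) (k : ℕ) :
    GrState T X L where
  e₁ := if W.e₁.val < k then some (σ.get W.e₁) else none
  pre := prefixSummary σ W.pre k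
  g₁ := grainSummary σ W.g₁ k
  g₂ := grainSummary σ W.g₂ k
  aft := depSet σ (W.g₁ ++ W.g₂) W.e₁ k
  phase := phaseAt W k

/-- `q 0, …, q n` is an accepting run of the automaton `A` on the word `w` of length `n`. -/
def AcceptingRun {α S : Type*} (A : NFA α S) (w : List α) (q : ℕ → S) : Prop :=
  q 0 ∈ A.start ∧ (∀ i : Fin w.length, q (i.val + 1) ∈ A.step (q i.val) (w.get i)) ∧
    q w.length ∈ A.accept

/-! ### Streaming algorithms -/

/-- Elementary instructions of a one-pass program with `p` lines and `s` bits of working memory: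
fetch the next input letter (`none` at the end of the input) and branch on it, test a bit and branch,
write a bit, halt with an answer. -/
inductive StreamInstr (α : Type*) (p s : ℕ) where
  | fetch (next : Option α → Fin p)
  | test (i : Fin s) (yes no : Fin p)
  | write (i : Fin s) (b : Bool) (next : Fin p)
  | halt (answer : Bool)

structure StreamProg (α : Type*) where
  lines : ℕ
  bits : ℕ
  code : Fin lines → StreamInstr α lines bits
  entry : Fin lines

structure StreamProg.Config {α : Type*} (P : StreamProg α) where
  pc : Fin P.lines
  mem : Fin P.bits → Bool
  input : List α

/-- One step of computation; a halted program stays where it is. -/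
def StreamProg.step {α : Type*} (P : StreamProg α) (c : P.Config) : P.Config :=
  match P.code c.pc with
  | .fetch next =>
    match c.input with
    | [] => ⟨next none, c.mem, []⟩
    | a :: u => ⟨next (some a), c.mem, u⟩
  | .test i yes no => ⟨if c.mem i then yes else no, c.mem, c.input⟩
  | .write i b next => ⟨next, Function.update c.mem i b, c.input⟩
  | .halt _ => c

/-- On input `w` the program halts with the given answer after at most `t` elementary steps. -/
def StreamProg.HaltsWithin {α : Type*} (P : StreamProg α) (w : List α) (t : ℕ)
    (answer : Bool) : Prop :=
  P.code (P.step^[t] ⟨P.entry, fun _ => false, w⟩).pc = .halt answer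

end RacePrediction

/-! The proof follows Büchi's theorem that monadic second-order properties of words are regular. A
witness consists of two positions and three sets of positions of the run. If "these positions and
sets form a witness" and "the summary after position `p` is `c`" are expressed by positions, sets of
positions, their order and their letters, then the runs decorated with the successive summaries of a
witness form a regular language (`Definable.summaries`). An automaton for $L_{\mathrm{GrPrefix}}$
guesses the decoration letter by letter, shows it in its state, and runs a DFA for the decorated
words next to it (`guessNFA`, `acceptingRun_guessNFA`). Determinizing it gives a finite control that
is itself the streaming program (`exists_streamProg`).

Formulas are not represented as syntax: `Definable` says that the codes of the satisfying
decorations form a regular language, and instance search composes the closure properties. Three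
notions do not speak of the order of the run directly.

The words `ρ ++ τ` need not follow the order of the run. Order in them reduces to membership and
order in the two parts (`before_append`), and well-formedness is regular and is checked by
simulating two passes at once (`isRegular_wellFormed`,
`Language.IsRegular.preimage_flatMap_append`).

A race quantifies over all equivalent reorderings. By `mRace_iff` it suffices that every event other
than $e_1$ that is causally after $e_1$ and occurs before $e_2$ is independent of $e_2$.

The causal future of $e_1$ is a least fixed point, hence an intersection of closed sets, which one
set quantifier expresses (`aftEvent_iff`). -/

open scoped Computability

set_option autoImplicit false
set_option linter.unusedVariables false
set_option synthInstance.maxSize 1000000000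
set_option synthInstance.maxHeartbeats 400000

/-! ### Closure properties of regular languages. -/

namespace Language

variable {α β : Type*}

/-- A finite family of languages that is closed under derivatives consists of regular languages. -/
theorem isRegular_of_derivatives {Q : Type*} [Finite Q] (L : Q → Language α) (step : Q → α → Q)
    (h : ∀ q a u, a :: u ∈ L q ↔ u ∈ L (step q a)) (q : Q) : (L q).IsRegular := by
  have := Fintype.ofFinite Q
  refine isRegular_iff.2 ⟨Q, inferInstance, ⟨step, q, {q | [] ∈ L q}⟩, ?_⟩
  ext u
  induction u generalizing q with
  | nil => exact Iff.rfl
  | cons a u ih => exact (ih (step q a)).trans (h q a u).symm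

theorem IsRegular.of_iff {L L' : Language α} (h : L.IsRegular) (e : ∀ u, u ∈ L' ↔ u ∈ L) :
    L'.IsRegular := by
  obtain rfl : L' = L := Language.ext e
  exact h

theorem isRegular_all (p : α → Prop) : IsRegular ({l : List α | ∀ a ∈ l, p a} : Language α) := by
  classical
  refine (isRegular_of_derivatives (Q := Bool)
    (fun q => {l : List α | q = true ∧ ∀ a ∈ l, p a}) (fun q a => q && decide (p a)) ?_ true).of_iff
      ?_
  · intro q a u
    change (_ ∧ _) ↔ (_ ∧ _)
    simp [and_assoc]
  · intro u
    change _ ↔ (_ ∧ _)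
    simp; rfl

theorem isRegular_exists (p : α → Prop) : IsRegular ({l : List α | ∃ a ∈ l, p a} : Language α) := by
  refine (isRegular_all fun a => ¬ p a).compl.of_iff fun u => ?_
  change _ ↔ ¬ _
  change (∃ a ∈ u, p a) ↔ ¬ ∀ a ∈ u, ¬ p a
  simp

/-- One bit records whether a letter with `p` has been seen; a later letter with `q` leads to the
dead state. Applied to marks, this expresses both uniqueness of a mark and the order of two marks.
-/
theorem isRegular_pairwise (p q : α → Prop) :
    IsRegular ({l : List α | l.Pairwise fun a b => ¬ (p a ∧ q b)} : Language α) := by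
  classical
  refine (isRegular_of_derivatives (Q := Option Bool)
    (fun s => s.casesOn 0 fun seen =>
      {l : List α | (l.Pairwise fun a b => ¬ (p a ∧ q b)) ∧ (seen = true → ∀ b ∈ l, ¬ q b)})
    (fun s a => s.casesOn none fun seen =>
      if seen = true ∧ q a then none else some (seen || decide (p a))) ?_ (some false)).of_iff ?_
  · rintro (_ | seen) a u
    · exact Iff.rfl
    · dsimp only
      split_ifs with hs
      · refine iff_of_false ?_ (fun h => h)
        rintro ⟨-, h⟩
        exact h hs.1 a List.mem_cons_self hs.2
      · change (_ ∧ _) ↔ (_ ∧ _)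
        simp only [List.pairwise_cons, List.mem_cons, Bool.or_eq_true, decide_eq_true_eq]
        grind
  · intro u
    change _ ↔ (_ ∧ _)
    simp; rfl

/-- Regular languages are closed under preimages of monoid homomorphisms. -/
theorem IsRegular.preimage_flatMap {L : Language β} (h : L.IsRegular) (f : α → List β) :
    IsRegular ({l : List α | l.flatMap f ∈ L} : Language α) := by
  obtain ⟨Q, _, M, rfl⟩ := h
  refine (isRegular_of_derivatives (fun q : Q => {l : List α | l.flatMap f ∈ M.acceptsFrom q})
    (fun q a => M.evalFrom q (f a)) ?_ M.start)
  intro q a u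
  change M.evalFrom q _ ∈ M.accept ↔ M.evalFrom _ _ ∈ M.accept
  simp [List.flatMap_cons, DFA.evalFrom_of_append]

theorem IsRegular.preimage_map {L : Language β} (h : L.IsRegular) (f : α → β) :
    IsRegular ({l : List α | l.map f ∈ L} : Language α) := by
  refine (h.preimage_flatMap fun a => [f a]).of_iff fun u => ?_
  change u.map f ∈ L ↔ u.flatMap _ ∈ L
  rw [List.map_eq_flatMap]

/-- Both passes over `l` are simulated in one: the start state of the second pass is not yet known,
so its whole transition function `Q → Q` is carried along with the current state of the first. -/
theorem IsRegular.preimage_flatMap_append {L : Language β} (h : L.IsRegular) (f g : α → List β) :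
    IsRegular ({l : List α | l.flatMap f ++ l.flatMap g ∈ L} : Language α) := by
  obtain ⟨Q, _, M, rfl⟩ := h
  refine isRegular_of_derivatives
    (fun s : Q × (Q → Q) =>
      {l : List α | M.evalFrom (s.2 (M.evalFrom s.1 (l.flatMap f))) (l.flatMap g) ∈ M.accept})
    (fun s a => (M.evalFrom s.1 (f a), fun q => M.evalFrom (s.2 q) (g a))) ?_ (M.start, id)
    |>.of_iff ?_
  · intro s a u
    change _ ∈ M.accept ↔ _ ∈ M.accept
    simp [List.flatMap_cons, DFA.evalFrom_of_append]
  · intro u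
    change M.evalFrom _ _ ∈ M.accept ↔ _ ∈ M.accept
    simp [DFA.evalFrom_of_append]

/-- Subset construction over the possible preimages of each letter. Erasing a track of the
decoration is such a map, so this is what yields existential quantifiers. -/
theorem IsRegular.map {L : Language α} (h : L.IsRegular) (f : α → β) :
    IsRegular (List.map f '' L : Language β) := by
  obtain ⟨Q, _, M, rfl⟩ := h
  refine (isRegular_of_derivatives (Q := Set Q)
    (fun S => {l : List β | ∃ u, u.map f = l ∧ ∃ q ∈ S, u ∈ M.acceptsFrom q})
    (fun S b => {q' | ∃ q ∈ S, ∃ a, f a = b ∧ M.step q a = q'}) ?_ {M.start}).of_iff ?_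
  · intro S b l
    change (∃ _, _) ↔ (∃ _, _)
    constructor
    · rintro ⟨u, hu, q, hq, hacc⟩
      obtain ⟨a, u, rfl, rfl, rfl⟩ := List.map_eq_cons_iff.1 hu
      exact ⟨u, rfl, _, ⟨q, hq, a, rfl, rfl⟩, hacc⟩
    · rintro ⟨u, rfl, q', ⟨q, hq, a, rfl, rfl⟩, hacc⟩
      exact ⟨a :: u, rfl, q, hq, hacc⟩
  · intro l
    change (∃ _, _) ↔ (∃ _, _)
    simp only [Set.mem_singleton_iff, exists_eq_left]
    exact exists_congr fun u => and_comm

theorem isRegular_forall {ι : Type*} [Finite ι] {L : ι → Language α} (h : ∀ i, (L i).IsRegular) :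
    IsRegular ({u | ∀ i, u ∈ L i} : Language α) := by
  classical
  have := Fintype.ofFinite ι
  have key (s : Finset ι) : IsRegular ({u | ∀ i ∈ s, u ∈ L i} : Language α) := by
    induction s using Finset.induction with
    | empty =>
      exact (isRegular_all fun _ => True).of_iff fun u =>
        iff_of_true (fun i hi => (Finset.notMem_empty i hi).elim) fun _ _ => trivial
    | insert i s _ ih => exact ((h i).inf ih).of_iff fun u => Finset.forall_mem_insert _ _ _
  exact (key Finset.univ).of_iff fun u =>
    ⟨fun hu i _ => hu i, fun hu i => hu i (Finset.mem_univ i)⟩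

theorem IsRegular.preimage_filter {L : Language α} (h : L.IsRegular) (p : α → Bool) :
    IsRegular ({l : List α | l.filter p ∈ L} : Language α) := by
  refine (h.preimage_flatMap fun a => if p a then [a] else []).of_iff fun u => ?_
  change u.filter p ∈ L ↔ u.flatMap _ ∈ L
  rw [iff_iff_eq]
  congr 1
  induction u with
  | nil => rfl
  | cons a u ih => cases ha : p a <;> simp [List.flatMap_cons, ha, ih]

theorem cons_mem_kstar {l : Language α} (hl : [] ∉ l) {a : α} {u : List α} :
    a :: u ∈ l∗ ↔ ∃ v w, a :: v ∈ l ∧ w ∈ l∗ ∧ u = v ++ w := by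
  rw [← one_add_self_mul_kstar_eq_kstar, mem_add, mem_one, mem_mul,
    one_add_self_mul_kstar_eq_kstar]
  constructor
  · rintro (h | ⟨p, hp, w, hw, e⟩)
    · cases h
    · rcases p with _ | ⟨b, v⟩
      · exact (hl hp).elim
      · obtain ⟨rfl, rfl⟩ := List.cons_eq_cons.1 e
        exact ⟨v, w, hp, hw, rfl⟩
  · rintro ⟨v, w, hv, hw, rfl⟩
    exact .inr ⟨_, hv, w, hw, rfl⟩

end Language

namespace RacePrediction

/-! ### Decorated words and the closure properties of definability. -/

section

universe u
variable {A : Type u}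

/-- A family of decorations of words over `A` that can be coded letter by letter over a finite
alphabet, with a regular set of codes. -/
class Coded (Γ : List A → Type) where
  Code : Type
  code : ∀ {σ : List A}, Γ σ → Fin σ.length → Code
  finite : Finite Code
  injective : ∀ {σ : List A}, Function.Injective (code (σ := σ))
  regular : Language.IsRegular ({l | ∃ (σ : List A) (γ : Γ σ), l = List.ofFn fun i : Fin σ.length =>
    (σ.get i, code γ i)} : Language (A × Code))

variable {Γ Δ : List A → Type} [Coded Γ] [Coded Δ]

namespace Coded

instance : Finite (Code Γ) := finite

/-- The word that encodes `σ` together with a decoration. -/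
def enc {σ : List A} (γ : Γ σ) : List (A × Code Γ) :=
  List.ofFn fun i : Fin σ.length => (σ.get i, code γ i)

theorem map_fst_enc {σ : List A} (γ : Γ σ) : (enc γ).map Prod.fst = σ := by
  simp [enc, List.map_ofFn, Function.comp_def]

theorem length_enc {σ : List A} (γ : Γ σ) : (enc γ).length = σ.length := by simp [enc]

theorem enc_inj {σ : List A} {γ γ' : Γ σ} : enc γ = enc γ' ↔ γ = γ' := by
  refine ⟨fun h => injective (funext fun i => ?_), fun h => h ▸ rfl⟩
  have := congrFun (List.ofFn_injective h) i
  exact (Prod.ext_iff.1 this).2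

theorem mem_enc {σ : List A} {γ : Γ σ} {b : A × Code Γ} :
    b ∈ enc γ ↔ ∃ i, (σ.get i, code γ i) = b := by
  simp [enc, List.mem_ofFn]

theorem pairwise_enc {σ : List A} {γ : Γ σ} {R : A × Code Γ → A × Code Γ → Prop} :
    (enc γ).Pairwise R ↔ ∀ i j, i < j → R (σ.get i, code γ i) (σ.get j, code γ j) := by
  simp [enc, List.pairwise_ofFn]

theorem flatMap_enc {σ : List A} {γ : Γ σ} {β : Type*} (f : A × Code Γ → List β) :
    (enc γ).flatMap f = (List.finRange σ.length).flatMap fun i => f (σ.get i, code γ i) := by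
  rw [enc, List.ofFn_eq_map, List.flatMap_map]

end Coded

open Coded

/-- The codes of the decorated words with property `P`. -/
def lang (P : ∀ σ, Γ σ → Prop) : Language (A × Code Γ) := {l | ∃ σ γ, P σ γ ∧ l = enc γ}

theorem enc_mem_lang {P : ∀ σ, Γ σ → Prop} {σ : List A} {γ : Γ σ} :
    enc γ ∈ lang P ↔ P σ γ := by
  refine ⟨fun ⟨σ', γ', h, e⟩ => ?_, fun h => ⟨σ, γ, h, rfl⟩⟩
  obtain rfl : σ = σ' := by rw [← map_fst_enc γ, e, map_fst_enc]
  rwa [enc_inj.1 e]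

/-- Properties of decorated words that are recognized by finite automata. -/
class Definable (P : ∀ σ, Γ σ → Prop) : Prop where
  regular : (lang P).IsRegular

/-- Since the valid codes are regular, `L` may behave arbitrarily on invalid ones: it is intersected
with them. -/
theorem Definable.of_isRegular {P : ∀ σ, Γ σ → Prop} {L : Language (A × Code Γ)}
    (hL : L.IsRegular) (h : ∀ σ (γ : Γ σ), P σ γ ↔ enc γ ∈ L) : Definable P := by
  refine ⟨(Coded.regular.inf hL).of_iff fun u => ?_⟩
  refine ⟨fun ⟨σ, γ, hP, e⟩ => ⟨⟨σ, γ, e⟩, e ▸ (h σ γ).1 hP⟩, ?_⟩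
  rintro ⟨⟨σ, γ, e⟩, hu⟩
  exact ⟨σ, γ, (h σ γ).2 (by rw [enc, ← e]; exact hu), e⟩

theorem Definable.congr {P Q : ∀ σ, Γ σ → Prop} [h : Definable Q] (e : ∀ σ γ, P σ γ ↔ Q σ γ) :
    Definable P :=
  .of_isRegular h.regular fun σ γ => (e σ γ).trans enc_mem_lang.symm

instance Definable.const (p : Prop) : Definable fun σ (_ : Γ σ) => p := by
  by_cases hp : p
  · exact .of_isRegular (Language.isRegular_all fun _ => True) fun σ γ =>
      iff_of_true hp fun _ _ => trivial
  · exact .of_isRegular (Language.isRegular_all fun _ => True).compl fun σ γ =>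
      iff_of_false hp fun h => h fun _ _ => trivial

instance Definable.and (P Q : ∀ σ, Γ σ → Prop) [hP : Definable P] [hQ : Definable Q] :
    Definable fun σ γ => P σ γ ∧ Q σ γ :=
  .of_isRegular (hP.regular.inf hQ.regular) fun σ γ => by
    rw [Language.mem_inf, enc_mem_lang, enc_mem_lang]

instance Definable.not (P : ∀ σ, Γ σ → Prop) [hP : Definable P] :
    Definable fun σ γ => ¬ P σ γ :=
  .of_isRegular hP.regular.compl fun σ γ => not_congr enc_mem_lang.symm

instance Definable.or (P Q : ∀ σ, Γ σ → Prop) [Definable P] [Definable Q] :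
    Definable fun σ γ => P σ γ ∨ Q σ γ :=
  .congr (Q := fun σ γ => ¬ (¬ P σ γ ∧ ¬ Q σ γ)) fun σ γ => by tauto

instance Definable.imp (P Q : ∀ σ, Γ σ → Prop) [Definable P] [Definable Q] :
    Definable fun σ γ => P σ γ → Q σ γ :=
  .congr (Q := fun σ γ => ¬ P σ γ ∨ Q σ γ) fun σ γ => by tauto

instance Definable.iff (P Q : ∀ σ, Γ σ → Prop) [Definable P] [Definable Q] :
    Definable fun σ γ => P σ γ ↔ Q σ γ :=
  .congr (Q := fun σ γ => (P σ γ → Q σ γ) ∧ (Q σ γ → P σ γ)) fun σ γ => by tauto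

instance Definable.finite_forall {ι : Type*} [Finite ι] (P : ι → ∀ σ, Γ σ → Prop)
    [h : ∀ i, Definable (P i)] : Definable fun σ γ => ∀ i, P i σ γ :=
  .of_isRegular (Language.isRegular_forall fun i => (h i).regular) fun σ γ =>
    forall_congr' fun i => enc_mem_lang.symm

instance Definable.finite_exists {ι : Type*} [Finite ι] (P : ι → ∀ σ, Γ σ → Prop)
    [h : ∀ i, Definable (P i)] : Definable fun σ γ => ∃ i, P i σ γ :=
  .congr (Q := fun σ γ => ¬ ∀ i, ¬ P i σ γ) fun σ γ => by simp

/-- Maps between decorations that act letter by letter. -/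
class IsLocal (f : ∀ σ, Γ σ → Δ σ) : Prop where
  exists_map : ∃ h : Code Γ → Code Δ, ∀ σ γ i, code (f σ γ) i = h (code γ i)

instance IsLocal.id : IsLocal fun σ (γ : Γ σ) => γ := ⟨_root_.id, fun _ _ _ => rfl⟩

theorem enc_local (f : ∀ σ, Γ σ → Δ σ) {h : Code Γ → Code Δ}
    (hf : ∀ σ γ i, code (f σ γ) i = h (code γ i)) (σ : List A) (γ : Γ σ) :
    enc (f σ γ) = (enc γ).map (Prod.map _root_.id h) := by
  simp [enc, List.map_ofFn, Function.comp_def, hf]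

/-- Substitution of terms for variables: a local map relabels each letter of the code, and
regularity passes to preimages under relabelling. -/
theorem Definable.comp (P : ∀ σ, Δ σ → Prop) [hP : Definable P] (f : ∀ σ, Γ σ → Δ σ)
    [hf : IsLocal f] : Definable fun σ γ => P σ (f σ γ) := by
  obtain ⟨h, hh⟩ := hf
  refine .of_isRegular (hP.regular.preimage_map (Prod.map _root_.id h)) fun σ γ => ?_
  rw [← enc_mem_lang (P := P), enc_local f hh]; rfl

instance Coded.prod : Coded fun σ => Γ σ × Δ σ where
  Code := Code Γ × Code Δ
  finite := inferInstance
  code γ i := (code γ.1 i, code γ.2 i)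
  injective h := Prod.ext (injective <| funext fun i => congrArg Prod.fst (congrFun h i))
    (injective <| funext fun i => congrArg Prod.snd (congrFun h i))
  regular := by
    refine ((Coded.regular (Γ := Γ).preimage_map (Prod.map _root_.id Prod.fst)).inf
      (Coded.regular (Γ := Δ).preimage_map (Prod.map _root_.id Prod.snd))).of_iff fun u => ?_
    constructor
    · rintro ⟨σ, ⟨γ, δ⟩, rfl⟩
      exact ⟨⟨σ, γ, by simp [List.map_ofFn, Function.comp_def]⟩,
        ⟨σ, δ, by simp [List.map_ofFn, Function.comp_def]⟩⟩
    · rintro ⟨⟨σ, γ, h₁⟩, ⟨σ', δ, h₂⟩⟩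
      change _ = enc γ at h₁
      change _ = enc δ at h₂
      -- Both decorations live on the same underlying word, the first components of `u`.
      obtain rfl : σ = σ' := by
        rw [← map_fst_enc γ, ← map_fst_enc δ, ← h₁, ← h₂]; simp [Function.comp_def]
      have hl : u.length = σ.length := by rw [← length_enc γ, ← h₁, List.length_map]
      refine ⟨σ, (γ, δ), List.ext_getElem (by simpa using hl) fun i hi hi' => ?_⟩
      have e₁ := List.getElem_of_eq h₁ (i := i) (by simpa using hi)
      have e₂ := List.getElem_of_eq h₂ (i := i) (by simpa using hi)
      simp only [enc, List.getElem_map, List.getElem_ofFn] at e₁ e₂ ⊢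
      simp only [Prod.ext_iff, Prod.map] at e₁ e₂ ⊢
      exact ⟨e₁.1, e₁.2, e₂.2⟩

section

variable {Θ : List A → Type} [Coded Θ]

instance IsLocal.fst (f : ∀ σ, Γ σ → Δ σ × Θ σ) [hf : IsLocal f] :
    IsLocal fun σ γ => (f σ γ).1 :=
  let ⟨h, hh⟩ := hf.exists_map
  ⟨fun c => (h c : Code Δ × Code Θ).1, fun σ γ i => (Prod.ext_iff.1 (hh σ γ i)).1⟩

instance IsLocal.snd (f : ∀ σ, Γ σ → Δ σ × Θ σ) [hf : IsLocal f] :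
    IsLocal fun σ γ => (f σ γ).2 :=
  let ⟨h, hh⟩ := hf.exists_map
  ⟨fun c => (h c : Code Δ × Code Θ).2, fun σ γ i => (Prod.ext_iff.1 (hh σ γ i)).2⟩

instance IsLocal.prodMk (f : ∀ σ, Γ σ → Δ σ) (g : ∀ σ, Γ σ → Θ σ) [hf : IsLocal f]
    [hg : IsLocal g] : IsLocal fun σ γ => (f σ γ, g σ γ) :=
  let ⟨h, hh⟩ := hf.exists_map
  let ⟨k, hk⟩ := hg.exists_map
  ⟨fun c => show Code Δ × Code Θ from (h c, k c), fun σ γ i => Prod.ext (hh σ γ i) (hk σ γ i)⟩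

end

/-- The quantified decoration is an additional track of the code, and the quantifier is the
projection that erases it. -/
theorem Definable.exists_coded (P : ∀ σ, Γ σ → Δ σ → Prop)
    [h : Definable fun σ (γ : Γ σ × Δ σ) => P σ γ.1 γ.2] : Definable fun σ γ => ∃ x, P σ γ x := by
  refine .of_isRegular (h.regular.map (Prod.map _root_.id (Prod.fst : Code Γ × Code Δ → Code Γ))) fun σ γ => ?_
  constructor
  · rintro ⟨x, hx⟩
    exact ⟨enc (Γ := fun σ => Γ σ × Δ σ) (γ, x), enc_mem_lang.2 hx,
      (enc_local (fun σ (γ : Γ σ × Δ σ) => γ.1) (fun _ _ _ => rfl) σ (γ, x)).symm⟩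
  · rintro ⟨u, ⟨σ', ⟨γ', x⟩, hP, rfl⟩, e⟩
    have e : enc γ' = enc γ :=
      (enc_local (fun σ (γ : Γ σ × Δ σ) => γ.1) (fun _ _ _ => rfl) σ' (γ', x)).trans e
    obtain rfl : σ' = σ := by rw [← map_fst_enc γ', e, map_fst_enc]
    exact ⟨x, enc_inj.1 e ▸ hP⟩

/-! ### Positions and subsequences -/

/-- Subsequences of a word. -/
abbrev Subseq (σ : List A) := {s : List (Fin σ.length) // s.Sublist (List.finRange σ.length)}

instance : Coded fun σ : List A => Fin σ.length where
  Code := Prop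
  finite := inferInstance
  code x i := i = x
  injective {_ x _} h := (congrFun h x).mp rfl
  regular := by
    -- A position is a marking with at least one and at most one marked letter.
    refine ((Language.isRegular_exists Prod.snd).inf
      (Language.isRegular_pairwise Prod.snd Prod.snd)).of_iff fun u => ?_
    constructor
    · rintro ⟨σ, x, rfl⟩
      refine ⟨⟨(σ.get x, True), ?_, trivial⟩, ?_⟩
      · exact List.mem_ofFn.2 ⟨x, by simp⟩
      · change List.Pairwise _ _
        rw [List.pairwise_ofFn]
        rintro i j hij ⟨h₁, h₂⟩
        exact hij.ne (h₁.trans h₂.symm)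
    · rintro ⟨⟨b, hb, hb'⟩, hp⟩
      obtain ⟨x, rfl⟩ := List.mem_iff_get.1 hb
      change List.Pairwise _ _ at hp
      rw [List.pairwise_iff_get] at hp
      refine ⟨u.map Prod.fst, x.cast (by simp), List.ext_getElem (by simp) fun i hi hi' => ?_⟩
      simp only [List.getElem_ofFn, List.get_eq_getElem, List.getElem_map]
      refine Prod.ext rfl (propext ?_)
      rw [Fin.ext_iff]
      simp only [Fin.val_cast]
      constructor
      · intro h
        rcases lt_trichotomy (⟨i, hi⟩ : Fin u.length) x with hlt | heq | hlt
        · exact (hp _ _ hlt ⟨h, hb'⟩).elim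
        · exact congrArg Fin.val heq
        · exact (hp _ _ hlt ⟨hb', h⟩).elim
      · rintro rfl
        exact hb'

theorem Subseq.pairwise {σ : List A} (s : Subseq σ) : s.1.Pairwise (· < ·) :=
  (List.sortedLT_finRange _).pairwise.sublist s.2

theorem Subseq.ext {σ : List A} {s t : Subseq σ} (h : ∀ i, i ∈ s.1 ↔ i ∈ t.1) : s = t := by
  refine Subtype.ext (List.Perm.eq_of_pairwise (le := (· < ·)) ?_ s.pairwise t.pairwise ?_)
  · intro a b _ _ h₁ h₂
    exact (lt_asymm h₁ h₂).elim
  · exact (List.perm_ext_iff_of_nodup (s.2.nodup (List.nodup_finRange _))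
      (t.2.nodup (List.nodup_finRange _))).2 h

open Classical in
/-- The subsequence of the positions with a given property. -/
noncomputable def subseq {σ : List A} (p : Fin σ.length → Prop) : Subseq σ :=
  ⟨(List.finRange σ.length).filter fun i => p i, List.filter_sublist⟩

@[simp]
theorem mem_subseq {σ : List A} {p : Fin σ.length → Prop} {i : Fin σ.length} :
    i ∈ (subseq p).1 ↔ p i := by
  simp [subseq]

theorem subseq_mem {σ : List A} (s : Subseq σ) : subseq (· ∈ s.1) = s :=
  Subseq.ext fun _ => mem_subseq

instance : Coded (Subseq (A := A)) where
  Code := Prop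
  finite := inferInstance
  code s i := i ∈ s.1
  injective h := Subseq.ext fun i => (congrFun h i).to_iff
  regular := by
    refine (Language.isRegular_all fun _ => True).of_iff fun u => iff_of_true ?_ fun _ _ => trivial
    refine ⟨u.map Prod.fst, subseq fun i => (u.get (i.cast (by simp))).2,
      List.ext_getElem (by simp) fun i hi hi' => ?_⟩
    simp

instance (n : ℕ) : Coded fun σ : List A => Fin σ.length → Fin n where
  Code := Fin n
  finite := inferInstance
  code d i := d i
  injective h := h
  regular := by
    refine (Language.isRegular_all fun _ => True).of_iff fun u => iff_of_true ?_ fun _ _ => trivial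
    refine ⟨u.map Prod.fst, fun i => (u.get (i.cast (by simp))).2,
      List.ext_getElem (by simp) fun i hi hi' => ?_⟩
    simp

end

/-! ### Definable atoms: quantifiers, letters, order and membership. -/

section

open Coded

universe u
variable {A : Type u} {Γ : List A → Type} [Coded Γ]

instance Definable.exists_pos (P : ∀ σ, Γ σ → Fin σ.length → Prop)
    [Definable fun σ (γ : Γ σ × Fin σ.length) => P σ γ.1 γ.2] :
    Definable fun σ γ => ∃ x, P σ γ x :=
  .exists_coded P

instance Definable.exists_subseq (P : ∀ σ, Γ σ → Subseq σ → Prop)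
    [Definable fun σ (γ : Γ σ × Subseq σ) => P σ γ.1 γ.2] :
    Definable fun σ γ => ∃ x, P σ γ x :=
  .exists_coded P

instance Definable.forall_pos (P : ∀ σ, Γ σ → Fin σ.length → Prop)
    [Definable fun σ (γ : Γ σ × Fin σ.length) => P σ γ.1 γ.2] :
    Definable fun σ γ => ∀ x, P σ γ x :=
  .congr (Q := fun σ γ => ¬ ∃ x, ¬ P σ γ x) fun σ γ => by simp

instance Definable.forall_subseq (P : ∀ σ, Γ σ → Subseq σ → Prop)
    [Definable fun σ (γ : Γ σ × Subseq σ) => P σ γ.1 γ.2] :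
    Definable fun σ γ => ∀ x, P σ γ x :=
  .congr (Q := fun σ γ => ¬ ∃ x, ¬ P σ γ x) fun σ γ => by simp

instance IsLocal.subseq_nil :
    IsLocal fun σ (_ : Γ σ) => (⟨[], List.nil_sublist _⟩ : Subseq σ) :=
  ⟨fun _ => False, fun _ _ i => propext (by simp [code])⟩

instance IsLocal.subseq_finRange :
    IsLocal fun σ (_ : Γ σ) => (⟨List.finRange σ.length, List.Sublist.refl _⟩ : Subseq σ) :=
  ⟨fun _ => True, fun _ _ i => propext (by simp [code])⟩

/-- A property of the letter at a position. -/
theorem Definable.of_letter (φ : A → Code Γ → Prop) (x : ∀ σ, Γ σ → Fin σ.length)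
    [hx : IsLocal x] : Definable fun σ γ => φ (σ.get (x σ γ)) (code γ (x σ γ)) := by
  obtain ⟨h, hh⟩ := hx
  replace hh : ∀ σ (γ : Γ σ) i, (i = x σ γ) = h (code γ i) := hh
  refine .of_isRegular (Language.isRegular_exists fun b => h b.2 ∧ φ b.1 b.2) fun σ γ => ?_
  change _ ↔ ∃ b ∈ enc γ, _
  simp only [mem_enc]
  constructor
  · intro hφ
    exact ⟨_, ⟨x σ γ, rfl⟩, (hh σ γ _).mp rfl, hφ⟩
  · rintro ⟨_, ⟨i, rfl⟩, hi, hφ⟩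
    obtain rfl := (hh σ γ i).mpr hi
    exact hφ

theorem Definable.letter (φ : A → Prop) (x : ∀ σ, Γ σ → Fin σ.length) [IsLocal x] :
    Definable fun σ γ => φ (σ.get (x σ γ)) :=
  .of_letter (fun a _ => φ a) x

/-- Finiteness of the alphabet turns a relation between two letters into a finite disjunction over
the value of the first. -/
theorem Definable.letter₂ [Finite A] (φ : A → A → Prop) (x y : ∀ σ, Γ σ → Fin σ.length)
    [IsLocal x] [IsLocal y] : Definable fun σ γ => φ (σ.get (x σ γ)) (σ.get (y σ γ)) := by
  have h₁ (a : A) := Definable.letter (Γ := Γ) (· = a) x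
  have h₂ (a : A) := Definable.letter (Γ := Γ) (φ a) y
  exact .congr (Q := fun σ γ => ∃ a, σ.get (x σ γ) = a ∧ φ a (σ.get (y σ γ))) fun σ γ => by simp

instance Definable.lt (x y : ∀ σ, Γ σ → Fin σ.length) [hx : IsLocal x] [hy : IsLocal y] :
    Definable fun σ γ => x σ γ < y σ γ := by
  obtain ⟨h, hh⟩ := hx
  obtain ⟨k, hk⟩ := hy
  replace hh : ∀ σ (γ : Γ σ) i, (i = x σ γ) = h (code γ i) := hh
  replace hk : ∀ σ (γ : Γ σ) i, (i = y σ γ) = k (code γ i) := hk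
  refine .of_isRegular (Language.isRegular_pairwise (fun b => h b.2) (fun b => k b.2)).compl
    fun σ γ => ?_
  change _ ↔ ¬ List.Pairwise _ (enc γ)
  rw [pairwise_enc]
  simp only [← hh, ← hk]
  grind

instance Definable.le (x y : ∀ σ, Γ σ → Fin σ.length) [IsLocal x] [IsLocal y] :
    Definable fun σ γ => x σ γ ≤ y σ γ :=
  .congr (Q := fun σ γ => ¬ y σ γ < x σ γ) fun σ γ => by simp

instance Definable.eq (x y : ∀ σ, Γ σ → Fin σ.length) [IsLocal x] [IsLocal y] :
    Definable fun σ γ => x σ γ = y σ γ :=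
  .congr (Q := fun σ γ => x σ γ ≤ y σ γ ∧ y σ γ ≤ x σ γ) fun σ γ => le_antisymm_iff

/-- Summaries are compared only after reading a position `p`, that is at `k = p + 1`, so that the
bounds `e.val < k` are comparisons of positions. -/
instance Definable.val_lt_succ (x y : ∀ σ, Γ σ → Fin σ.length) [IsLocal x] [IsLocal y] :
    Definable fun σ γ => (x σ γ).val < (y σ γ).val + 1 :=
  .congr (Q := fun σ γ => x σ γ ≤ y σ γ) fun σ γ => Nat.lt_succ_iff

instance Definable.succ_le_val (x y : ∀ σ, Γ σ → Fin σ.length) [IsLocal x] [IsLocal y] :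
    Definable fun σ γ => (x σ γ).val + 1 ≤ (y σ γ).val :=
  .congr (Q := fun σ γ => x σ γ < y σ γ) fun σ γ => Iff.rfl

instance Definable.mem_subseq (x : ∀ σ, Γ σ → Fin σ.length) (s : ∀ σ, Γ σ → Subseq σ) [IsLocal x]
    [hs : IsLocal s] : Definable fun σ γ => x σ γ ∈ (s σ γ).1 := by
  obtain ⟨h, hh⟩ := hs
  have := Definable.of_letter (fun _ c => h c) x
  exact .congr (Q := fun σ γ => h (code γ (x σ γ))) fun σ γ => (hh σ γ (x σ γ)).to_iff

instance Definable.mem_append (x : ∀ σ, Γ σ → Fin σ.length)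
    (s t : ∀ σ, Γ σ → List (Fin σ.length)) [Definable fun σ γ => x σ γ ∈ s σ γ]
    [Definable fun σ γ => x σ γ ∈ t σ γ] : Definable fun σ γ => x σ γ ∈ s σ γ ++ t σ γ :=
  .congr (Q := fun σ γ => x σ γ ∈ s σ γ ∨ x σ γ ∈ t σ γ) fun σ γ => List.mem_append

instance Definable.apply_eq {n : ℕ} (d : ∀ σ, Γ σ → Fin σ.length → Fin n)
    (x : ∀ σ, Γ σ → Fin σ.length) (c : Fin n) [hd : IsLocal d] [IsLocal x] :
    Definable fun σ γ => d σ γ (x σ γ) = c := by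
  obtain ⟨h, hh⟩ := hd
  replace hh : ∀ σ (γ : Γ σ) i, d σ γ i = h (code γ i) := hh
  have := Definable.of_letter (fun _ b => h b = c) x
  exact .congr (Q := fun σ γ => h (code γ (x σ γ)) = c) fun σ γ => by rw [hh]

theorem map_get_subseq {σ : List A} (γ : Γ σ) (s : Subseq σ) {h : Code Γ → Prop}
    [DecidablePred h] (hh : ∀ i, i ∈ s.1 ↔ h (code γ i)) :
    s.1.map σ.get = (enc γ).flatMap fun b => if h b.2 then [b.1] else [] := by
  classical
  rw [flatMap_enc, ← subseq_mem s]
  simp only [subseq, hh]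
  induction List.finRange σ.length with
  | nil => rfl
  | cons i l ih => by_cases hi : h (code γ i) <;> simp [List.flatMap_cons, hi, ih]

theorem Definable.append_mem {L : Language A} (hL : L.IsRegular) (s t : ∀ σ, Γ σ → Subseq σ)
    [hs : IsLocal s] [ht : IsLocal t] :
    Definable fun σ γ => ((s σ γ).1 ++ (t σ γ).1).map σ.get ∈ L := by
  classical
  obtain ⟨h, hh⟩ := hs
  obtain ⟨k, hk⟩ := ht
  refine .of_isRegular (hL.preimage_flatMap_append
    (fun b => if h b.2 then [b.1] else []) (fun b => if k b.2 then [b.1] else [])) fun σ γ => ?_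
  rw [List.map_append, map_get_subseq γ _ fun i => (hh σ γ i).to_iff,
    map_get_subseq γ _ fun i => (hk σ γ i).to_iff]
  rfl

theorem before_cons {E : Type*} {a : E} {s : List E} {e f : E} :
    Before (a :: s) e f ↔ Before s e f ∨ (e = a ∧ f ∈ s) := by
  unfold Before
  rw [List.sublist_cons_iff]
  simp

theorem before_append {E : Type*} {s t : List E} {e f : E} :
    Before (s ++ t) e f ↔ Before s e f ∨ Before t e f ∨ (e ∈ s ∧ f ∈ t) := by
  induction s with
  | nil => simp [Before]
  | cons a s ih =>
    rw [List.cons_append, before_cons, before_cons, ih, List.mem_append, List.mem_cons,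
      and_or_left, or_and_right]
    simp only [or_assoc, or_left_comm, or_comm]

theorem before_iff_of_pairwise {E : Type*} [Preorder E] {s : List E} (h : s.Pairwise (· < ·))
    {e f : E} : Before s e f ↔ e ∈ s ∧ f ∈ s ∧ e < f := by
  induction s with
  | nil => simp [Before]
  | cons a s ih =>
    rw [List.pairwise_cons] at h
    rw [before_cons, ih h.2, List.mem_cons, List.mem_cons]
    grind

theorem Subseq.before_iff {σ : List A} (s : Subseq σ) {e f : Fin σ.length} :
    Before s.1 e f ↔ e ∈ s.1 ∧ f ∈ s.1 ∧ e < f :=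
  before_iff_of_pairwise s.pairwise

instance Definable.before_subseq (s : ∀ σ, Γ σ → Subseq σ) (x y : ∀ σ, Γ σ → Fin σ.length)
    [IsLocal s] [IsLocal x] [IsLocal y] :
    Definable fun σ γ => Before (s σ γ).1 (x σ γ) (y σ γ) :=
  .congr (Q := fun σ γ => x σ γ ∈ (s σ γ).1 ∧ y σ γ ∈ (s σ γ).1 ∧ x σ γ < y σ γ)
    fun σ γ => (s σ γ).before_iff

instance Definable.before_append (s t : ∀ σ, Γ σ → Subseq σ) (x y : ∀ σ, Γ σ → Fin σ.length)
    [IsLocal s] [IsLocal t] [IsLocal x] [IsLocal y] :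
    Definable fun σ γ => Before ((s σ γ).1 ++ (t σ γ).1) (x σ γ) (y σ γ) :=
  .congr (Q := fun σ γ => Before (s σ γ).1 (x σ γ) (y σ γ) ∨ Before (t σ γ).1 (x σ γ) (y σ γ) ∨
    (x σ γ ∈ (s σ γ).1 ∧ y σ γ ∈ (t σ γ).1)) fun σ γ => RacePrediction.before_append

end

/-! ### Atoms about threads, actions and reads-from. -/

section

variable {T X L : Type*}

instance [Finite X] [Finite L] : Finite (Action X L) := by
  let f : Action X L → (X ⊕ X) ⊕ (L ⊕ L)
    | .read x => .inl (.inl x)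
    | .write x => .inl (.inr x)
    | .acq l => .inr (.inl l)
    | .rel l => .inr (.inr l)
  refine Finite.of_injective f fun a b h => ?_
  cases a <;> cases b <;> simp_all [f]

instance [Finite T] [Finite X] [Finite L] : Finite (Label T X L) :=
  Finite.of_injective (fun a => (a.thread, a.act)) fun a b h => by
    cases a; cases b; simp_all

variable {Γ : List (Label T X L) → Type} [Coded Γ]
  (x y : ∀ σ, Γ σ → Fin σ.length) [IsLocal x] [IsLocal y]

instance Definable.thread_eq (t : T) : Definable fun σ γ => (σ.get (x σ γ)).thread = t :=
  .letter (fun a => a.thread = t) x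

instance Definable.act_eq (o : Action X L) : Definable fun σ γ => (σ.get (x σ γ)).act = o :=
  .letter (fun a => a.act = o) x

instance Definable.obj_eq (d : X ⊕ L) : Definable fun σ γ => (σ.get (x σ γ)).act.obj = d :=
  .letter (fun a => a.act.obj = d) x

instance Definable.some_get_eq (a : Option (Label T X L)) :
    Definable fun σ γ => some (σ.get (x σ γ)) = a :=
  .letter (fun b => some b = a) x

variable [Finite T] [Finite X] [Finite L]

instance Definable.thread_eq_thread :
    Definable fun σ γ => (σ.get (x σ γ)).thread = (σ.get (y σ γ)).thread :=
  .letter₂ (fun a b => a.thread = b.thread) x y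

instance Definable.indep : Definable fun σ γ => Indep (σ.get (x σ γ)) (σ.get (y σ γ)) :=
  .letter₂ Indep x y

instance Definable.conflict : Definable fun σ γ => Conflict (σ.get (x σ γ)) (σ.get (y σ γ)) :=
  .letter₂ Conflict x y

instance Definable.progOrder : Definable fun σ γ => ProgOrder σ (x σ γ) (y σ γ) := by
  unfold ProgOrder; infer_instance

variable (s t : ∀ σ, Γ σ → Subseq σ) [IsLocal s] [IsLocal t]

instance Definable.readsFrom_append :
    Definable fun σ γ => ReadsFrom σ.get ((s σ γ).1 ++ (t σ γ).1) (x σ γ) (y σ γ) :=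
  -- Definability is first derived for plain variables, the projections of a tuple; arbitrary local
  -- terms are then substituted by `Definable.comp`. Later instances follow the same pattern.
  have : Definable fun σ (p : Subseq σ × Subseq σ × Fin σ.length × Fin σ.length) =>
      ReadsFrom σ.get (p.1.1 ++ p.2.1.1) p.2.2.1 p.2.2.2 := by
    unfold ReadsFrom; infer_instance
  this.comp _ fun σ γ => (s σ γ, t σ γ, x σ γ, y σ γ)

end

/-! ### Prefixes and contiguous subwords in terms of the order. -/

section

variable {A : Type*} {σ : List A}

theorem Subseq.eq_of_pairwise (s : Subseq σ) {l : List (Fin σ.length)} (hl : l.Pairwise (· < ·))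
    (h : ∀ i, i ∈ s.1 ↔ i ∈ l) : s.1 = l := by
  refine List.Perm.eq_of_pairwise (le := (· < ·)) (fun a b _ _ h₁ h₂ => (lt_asymm h₁ h₂).elim)
    s.pairwise hl ?_
  exact (List.perm_ext_iff_of_nodup (s.2.nodup (List.nodup_finRange _))
    (hl.imp fun h => h.ne)).2 h

theorem sublist_finRange_of_pairwise {n : ℕ} {l : List (Fin n)} (hl : l.Pairwise (· < ·)) :
    l.Sublist (List.finRange n) := by
  have : l = (List.finRange n).filter (· ∈ l) := by
    refine List.Perm.eq_of_pairwise (le := (· < ·)) (fun a b _ _ h₁ h₂ => (lt_asymm h₁ h₂).elim)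
      hl ((List.sortedLT_finRange n).pairwise.filter _) ?_
    refine (List.perm_ext_iff_of_nodup (hl.imp fun h => h.ne)
      ((List.nodup_finRange _).filter _)).2 fun i => by simp
  rw [this]
  exact List.filter_sublist

theorem Subseq.sublist_iff {s t : Subseq σ} : s.1.Sublist t.1 ↔ ∀ i ∈ s.1, i ∈ t.1 := by
  refine ⟨fun h i hi => h.subset hi, fun h => ?_⟩
  rw [s.eq_of_pairwise (l := t.1.filter (· ∈ s.1)) (t.pairwise.filter _) fun i => by
    simpa using h i]
  exact List.filter_sublist

theorem Subseq.prefix_iff {s t : Subseq σ} :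
    s.1 <+: t.1 ↔ (∀ i ∈ s.1, i ∈ t.1) ∧ ∀ a ∈ s.1, ∀ b ∈ t.1, b < a → b ∈ s.1 := by
  constructor
  · rintro ⟨v, hv⟩
    have hp := t.pairwise
    rw [← hv, List.pairwise_append] at hp
    refine ⟨fun i hi => hv ▸ List.mem_append_left v hi, fun a ha b hb hlt => ?_⟩
    rw [← hv, List.mem_append] at hb
    exact hb.resolve_right fun h => lt_asymm hlt (hp.2.2 a ha b h)
  · rintro ⟨h₁, h₂⟩
    refine ⟨t.1.filter (· ∉ s.1), (t.eq_of_pairwise ?_ fun i => ?_).symm⟩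
    · rw [List.pairwise_append]
      refine ⟨s.pairwise, t.pairwise.filter _, fun a ha b hb => ?_⟩
      simp only [List.mem_filter, decide_eq_true_eq] at hb
      by_contra hlt
      rcases (not_lt.1 hlt).lt_or_eq with h | rfl
      · exact hb.2 (h₂ a ha b hb.1 h)
      · exact hb.2 ha
    · simp only [List.mem_append, List.mem_filter, decide_eq_true_eq]
      have := h₁ i
      tauto

/-- As both lists are increasing, contiguity is convexity of `s` inside `t`. -/
theorem Subseq.infix_iff {s t : Subseq σ} :
    s.1 <:+: t.1 ↔ (∀ i ∈ s.1, i ∈ t.1) ∧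
      ∀ a ∈ s.1, ∀ b ∈ t.1, ∀ c ∈ s.1, a < b → b < c → b ∈ s.1 := by
  constructor
  · rintro ⟨u, v, hv⟩
    have hp := t.pairwise
    rw [← hv, List.pairwise_append, List.pairwise_append] at hp
    refine ⟨fun i hi => by simp [← hv, hi], fun a ha b hb c hc hab hbc => ?_⟩
    rw [← hv, List.mem_append, List.mem_append] at hb
    rcases hb with (hb | hb) | hb
    · exact (lt_asymm hab (hp.1.2.2 b hb a ha)).elim
    · exact hb
    · exact (lt_asymm hbc (hp.2.2 c (List.mem_append_right _ hc) b hb)).elim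
  · rintro ⟨h₁, h₂⟩
    -- The left part consists of the elements below all of `s`; for empty `s` this is all of `t`,
    -- and the right part is then empty.
    refine ⟨t.1.filter fun i => ∀ a ∈ s.1, i < a,
      t.1.filter fun i => i ∉ s.1 ∧ ¬ ∀ a ∈ s.1, i < a,
      (t.eq_of_pairwise ?_ fun i => ?_).symm⟩
    · rw [List.pairwise_append, List.pairwise_append]
      simp only [List.mem_append, List.mem_filter, decide_eq_true_eq]
      refine ⟨⟨t.pairwise.filter _, s.pairwise, fun a ha b hb => ha.2 b hb⟩, t.pairwise.filter _,
        ?_⟩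
      rintro a ha b ⟨hb, hbs, hb'⟩
      push Not at hb'
      obtain ⟨c, hc, hcb⟩ := hb'
      rcases ha with ha | ha
      · exact (ha.2 c hc).trans_le hcb
      · by_contra hlt
        have hne : b ≠ a := fun h => hbs (h ▸ ha)
        have hne' : c ≠ b := fun h => hbs (h ▸ hc)
        exact hbs (h₂ c hc b hb a ha (hcb.lt_of_ne hne') ((not_lt.1 hlt).lt_of_ne hne))
    · simp only [List.mem_append, List.mem_filter, decide_eq_true_eq]
      have := h₁ i
      tauto

end

/-! ### Well-formedness is regular. -/

section

variable {T X L : Type*}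

theorem cons_mem_opLang {o : Action X L} {a : Label T X L} {u : List (Label T X L)} :
    a :: u ∈ opLang o ↔ a.act = o ∧ u = [] := by
  obtain ⟨t, b⟩ := a
  change (∃ _, _) ↔ _
  simp

theorem nil_notMem_opLang {o : Action X L} : [] ∉ (opLang o : Language (Label T X L)) := by
  rintro ⟨t, h⟩
  cases h

theorem cons_mem_opLang_kstar {o : Action X L} {a : Label T X L} {u : List (Label T X L)} :
    a :: u ∈ (opLang o : Language (Label T X L))∗ ↔ a.act = o ∧ u ∈ (opLang o)∗ := by
  rw [Language.cons_mem_kstar nil_notMem_opLang]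
  simp only [cons_mem_opLang]
  constructor
  · rintro ⟨_, w, ⟨h, rfl⟩, hw, rfl⟩
    exact ⟨h, hw⟩
  · rintro ⟨h, hu⟩
    exact ⟨[], u, ⟨h, rfl⟩, hu, rfl⟩

/-- The derivatives of the language are itself, `R * A` and the empty language: only a `w` may come
first, and from then on `w` and `r` are both always allowed. -/
theorem isRegular_location (w r : Action X L) :
    ((opLang w * (opLang r)∗)∗ : Language (Label T X L)).IsRegular := by
  classical
  set R : Language (Label T X L) := (opLang r)∗
  set A : Language (Label T X L) := (opLang w * R)∗ with hA
  have hnil : [] ∉ opLang w * R := by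
    rintro ⟨p, hp, q, -, e⟩
    obtain ⟨rfl, -⟩ := List.append_eq_nil_iff.1 e
    exact nil_notMem_opLang hp
  have h₁ (a : Label T X L) (u : List (Label T X L)) : a :: u ∈ A ↔ a.act = w ∧ u ∈ R * A := by
    rw [hA, Language.cons_mem_kstar hnil, ← hA]
    constructor
    · rintro ⟨v, q, ⟨p, hp, v', hv, e⟩, hq, rfl⟩
      rcases p with _ | ⟨b, p⟩
      · exact (nil_notMem_opLang hp).elim
      · obtain ⟨rfl, rfl⟩ := List.cons_eq_cons.1 e
        obtain ⟨h, rfl⟩ := cons_mem_opLang.1 hp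
        exact ⟨h, v', hv, q, hq, rfl⟩
    · rintro ⟨h, v, hv, q, hq, rfl⟩
      exact ⟨v, q, ⟨[a], cons_mem_opLang.2 ⟨h, rfl⟩, v, hv, rfl⟩, hq, rfl⟩
  have h₂ (a : Label T X L) (u : List (Label T X L)) :
      a :: u ∈ R * A ↔ (a.act = w ∨ a.act = r) ∧ u ∈ R * A := by
    constructor
    · rintro ⟨p, hp, q, hq, e⟩
      rcases p with _ | ⟨b, p⟩
      · obtain rfl : q = a :: u := e
        exact ⟨.inl ((h₁ a u).1 hq).1, ((h₁ a u).1 hq).2⟩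
      · obtain ⟨rfl, rfl⟩ := List.cons_eq_cons.1 e
        obtain ⟨h, hp⟩ := cons_mem_opLang_kstar.1 hp
        exact ⟨.inr h, p, hp, q, hq, rfl⟩
    · rintro ⟨h | h, hu⟩
      · exact ⟨[], Language.nil_mem_kstar _, _, (h₁ a u).2 ⟨h, hu⟩, rfl⟩
      · obtain ⟨p, hp, q, hq, rfl⟩ := hu
        exact ⟨a :: p, cons_mem_opLang_kstar.2 ⟨h, hp⟩, q, hq, rfl⟩
  refine Language.isRegular_of_derivatives (Q := Option Bool)
    (fun s => s.casesOn 0 fun b => if b then R * A else A)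
    (fun s a => s.casesOn none fun b =>
      if a.act = w ∨ (b = true ∧ a.act = r) then some true else none) ?_ (some false)
  rintro (_ | _ | _) a u
  · exact Iff.rfl
  · by_cases h : a.act = w
    · simp [h, h₁]
    · simp [h, h₁, Language.notMem_zero]
  · by_cases h : a.act = w
    · simp [h, h₂]
    · by_cases h' : a.act = r
      · simp [h', h₂]
      · simp [h, h', h₂, Language.notMem_zero]

theorem cons_mem_critLang {l : L} {a : Label T X L} {u : List (Label T X L)} :
    a :: u ∈ critLang l ↔ ∃ t, a = ⟨t, .acq l⟩ ∧ u = [⟨t, .rel l⟩] := by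
  change (∃ _, _) ↔ _
  simp

theorem isRegular_lock [Finite T] (l : L) :
    ((critLang l)∗ * (opLang (.acq l) + 1) : Language (Label T X L)).IsRegular := by
  classical
  set C : Language (Label T X L) := (critLang l)∗ with hC
  set G : Language (Label T X L) := C * (opLang (.acq l) + 1) with hG
  -- `G` is the derivative while the lock is free and `H t` the one while `t` holds it; in the
  -- latter the word may end, which is the open acquire.
  let H (t : T) : Language (Label T X L) := {u | u = [] ∨ ∃ v ∈ G, u = ⟨t, .rel l⟩ :: v}
  have hnil : [] ∉ (critLang l : Language (Label T X L)) := by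
    rintro ⟨t, h⟩
    cases h
  have h₁ (a : Label T X L) (u : List (Label T X L)) :
      a :: u ∈ G ↔ a.act = .acq l ∧ u ∈ H a.thread := by
    constructor
    · rintro ⟨p, hp, q, hq, e⟩
      rcases p with _ | ⟨b, p⟩
      · obtain rfl : q = a :: u := e
        rcases hq with hq | hq
        · obtain ⟨h, rfl⟩ := cons_mem_opLang.1 hq
          exact ⟨h, .inl rfl⟩
        · cases hq
      · obtain ⟨rfl, rfl⟩ := List.cons_eq_cons.1 e
        obtain ⟨v, w, hv, hw, rfl⟩ := (Language.cons_mem_kstar hnil).1 hp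
        obtain ⟨t, rfl, rfl⟩ := cons_mem_critLang.1 hv
        exact ⟨rfl, .inr ⟨_, ⟨w, hw, q, hq, rfl⟩, rfl⟩⟩
    · obtain ⟨t, o⟩ := a
      rintro ⟨rfl, rfl | ⟨_, ⟨w, hw, q, hq, rfl⟩, rfl⟩⟩
      · exact ⟨[], Language.nil_mem_kstar _, _, .inl ⟨t, rfl⟩, rfl⟩
      · exact ⟨⟨t, .acq l⟩ :: ⟨t, .rel l⟩ :: w,
          (Language.cons_mem_kstar hnil).2 ⟨_, w, cons_mem_critLang.2 ⟨t, rfl, rfl⟩, hw, rfl⟩,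
          q, hq, rfl⟩
  have h₂ (t : T) (a : Label T X L) (u : List (Label T X L)) :
      a :: u ∈ H t ↔ a = ⟨t, .rel l⟩ ∧ u ∈ G := by
    change (_ = [] ∨ _) ↔ _
    simp only [reduceCtorEq, List.cons.injEq, false_or]
    constructor
    · rintro ⟨v, hv, rfl, rfl⟩
      exact ⟨rfl, hv⟩
    · rintro ⟨rfl, hu⟩
      exact ⟨u, hu, rfl, rfl⟩
  refine Language.isRegular_of_derivatives (Q := Option (Option T))
    (fun s => s.casesOn 0 fun b => b.casesOn G H)
    (fun s a => s.casesOn none fun b => b.casesOn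
      (if a.act = .acq l then some (some a.thread) else none)
      (fun t => if a = ⟨t, .rel l⟩ then some none else none)) ?_ (some none)
  rintro (_ | _ | t) a u
  · exact Iff.rfl
  · by_cases h : a.act = .acq l
    · simp [h, h₁]
    · simp [h, h₁, Language.notMem_zero]
  · by_cases h : a = ⟨t, .rel l⟩
    · simp [h, h₂]
    · simp [h, h₂, Language.notMem_zero]

theorem isRegular_wellFormed [Finite T] [Finite X] [Finite L] :
    Language.IsRegular ({σ | WellFormed σ} : Language (Label T X L)) := by
  classical
  refine ((Language.isRegular_forall fun x : X =>
    (isRegular_location (.write x) (.read x)).preimage_filter fun a : Label T X L =>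
      a.act.obj = .inl x).inf (Language.isRegular_forall fun l : L =>
    (isRegular_lock l).preimage_filter fun a : Label T X L => a.act.obj = .inr l)).of_iff
      fun σ => ?_
  refine and_congr (forall_congr' fun x => ?_) (forall_congr' fun l => ?_) <;>
  · rw [projObj]
    exact Iff.rfl

end

/-! ### Mazurkiewicz equivalence and the causal criterion for races. -/

section

variable {T X L E : Type*} {lab : E → Label T X L}

theorem Indep.symm {a b : Label T X L} (h : Indep a b) : Indep b a :=
  ⟨h.1.symm, fun e => let ⟨x, ha, hb⟩ := h.2 e.symm; ⟨x, hb, ha⟩⟩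

theorem Conflict.not_indep {a b : Label T X L} (h : Conflict a b) : ¬ Indep a b := by
  rintro ⟨-, hi⟩
  obtain ⟨x, ha, hb, hw⟩ := h
  obtain ⟨y, hy, hy'⟩ := hi (ha.trans hb.symm)
  rw [hy, hy'] at hw
  simp at hw

theorem MazEquiv.perm {s s' : List E} (h : MazEquiv lab s s') : s.Perm s' := by
  induction h with
  | rel s s' h =>
    obtain ⟨u, v, a, b, -, rfl, rfl⟩ := h
    exact (List.Perm.swap b a v).append_left u
  | refl => exact .refl _
  | symm _ _ _ ih => exact ih.symm
  | trans _ _ _ _ _ ih ih' => exact ih.trans ih'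

/-- A swap of neighbours changes the order of that pair only, and the pair is independent. -/
theorem MazEquiv.before_iff {s s' : List E} (h : MazEquiv lab s s') {e f : E}
    (hd : ¬ Indep (lab e) (lab f)) : Before s e f ↔ Before s' e f := by
  induction h with
  | rel s s' h =>
    obtain ⟨u, v, a, b, hab, rfl, rfl⟩ := h
    have h₁ : ¬ (e = a ∧ f = b) := by rintro ⟨rfl, rfl⟩; exact hd hab
    have h₂ : ¬ (e = b ∧ f = a) := by rintro ⟨rfl, rfl⟩; exact hd hab.symm
    simp only [before_append, before_cons, List.mem_cons]
    grind
  | refl => exact Iff.rfl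
  | symm _ _ _ ih => exact ih.symm
  | trans _ _ _ _ _ ih ih' => exact ih.trans ih'

theorem MazEquiv.aftEvent {s s' : List E} (h : MazEquiv lab s s') {e f : E}
    (ha : AftEvent lab s e f) : AftEvent lab s' e f := by
  induction ha with
  | base => exact .base
  | step _ hb hd ih => exact ih.step ((h.before_iff hd).1 hb) hd

theorem AftEvent.mono {s s' : List E} (hs : s.Sublist s') {e f : E} (h : AftEvent lab s e f) :
    AftEvent lab s' e f := by
  induction h with
  | base => exact .base
  | step _ hb hd ih => exact ih.step (hb.trans hs) hd

theorem Before.mem {s : List E} {e f : E} (h : Before s e f) : e ∈ s ∧ f ∈ s :=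
  ⟨h.subset (by simp), h.subset (by simp)⟩

theorem Before.trans_of_nodup {s : List E} (hs : s.Nodup) {a b c : E} (h : Before s a b)
    (h' : Before s b c) : Before s a c := by
  induction s with
  | nil => cases h
  | cons d s ih =>
    rw [List.nodup_cons] at hs
    rw [before_cons] at h h' ⊢
    rcases h' with h' | ⟨rfl, hc⟩
    · rcases h with h | ⟨rfl, hb⟩
      · exact .inl (ih hs.2 h h')
      · exact .inr ⟨rfl, h'.mem.2⟩
    · rcases h with h | ⟨rfl, hb⟩
      · exact (hs.1 h.mem.2).elim
      · exact (hs.1 hb).elim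

theorem Before.asymm_of_nodup {s : List E} (hs : s.Nodup) {a b : E} (h : Before s a b) :
    ¬ Before s b a := by
  intro h'
  have := h.trans_of_nodup hs h'
  simpa using hs.sublist this

theorem AftEvent.eq_or_before {s : List E} (hs : s.Nodup) {e f : E} (h : AftEvent lab s e f) :
    f = e ∨ Before s e f := by
  induction h with
  | base => exact .inl rfl
  | step _ hb _ ih =>
    rcases ih with rfl | ih
    · exact .inr hb
    · exact .inr (ih.trans_of_nodup hs hb)

theorem Before.cases_of_nodup {u v : List E} {a f : E} (hs : (u ++ a :: v).Nodup) :
    (Before (u ++ a :: v) f a → f ∈ u) ∧ (Before (u ++ a :: v) a f → f ∈ v) := by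
  rw [List.nodup_append, List.nodup_cons] at hs
  rw [before_append, before_append, before_cons, before_cons]
  have hu : a ∉ u := fun h => hs.2.2 a h a List.mem_cons_self rfl
  constructor
  · rintro (h | (h | h) | h)
    · exact (hu h.mem.2).elim
    · exact (hs.2.1.1 h.mem.2).elim
    · exact (hs.2.1.1 h.2).elim
    · exact h.1
  · rintro (h | (h | h) | h)
    · exact (hu h.mem.1).elim
    · exact (hs.2.1.1 h.mem.1).elim
    · exact h.2
    · exact (hu h.1).elim

theorem MazEquiv.append_left {s s' : List E} (h : MazEquiv lab s s') (u : List E) :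
    MazEquiv lab (u ++ s) (u ++ s') := by
  induction h with
  | rel s s' h =>
    obtain ⟨w, v, a, b, hab, rfl, rfl⟩ := h
    exact .rel _ _ ⟨u ++ w, v, a, b, hab, by simp, by simp⟩
  | refl => exact .refl _
  | symm _ _ _ ih => exact ih.symm
  | trans _ _ _ _ _ ih ih' => exact ih.trans _ _ _ ih'

theorem MazEquiv.append_right {s s' : List E} (h : MazEquiv lab s s') (v : List E) :
    MazEquiv lab (s ++ v) (s' ++ v) := by
  induction h with
  | rel s s' h =>
    obtain ⟨u, w, a, b, hab, rfl, rfl⟩ := h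
    exact .rel _ _ ⟨u, w ++ v, a, b, hab, by simp, by simp⟩
  | refl => exact .refl _
  | symm _ _ _ ih => exact ih.symm
  | trans _ _ _ _ _ ih ih' => exact ih.trans _ _ _ ih'

theorem mazEquiv_append_singleton {s : List E} {a : E} (h : ∀ b ∈ s, Indep (lab b) (lab a)) :
    MazEquiv lab (s ++ [a]) (a :: s) := by
  induction s with
  | nil => exact .refl _
  | cons b s ih =>
    rw [List.forall_mem_cons] at h
    exact ((ih h.2).append_left [b]).trans _ _ _ (.rel _ _ ⟨[], s, b, a, h.1, rfl, rfl⟩)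

/-- The events of `m` that do not depend on `e` can be moved in front of `e`. -/
theorem exists_mazEquiv_cons (e : E) (m : List E) : ∃ p q, MazEquiv lab (e :: m) (p ++ e :: q) ∧
    ∀ f ∈ q, AftEvent lab (e :: m) e f := by
  induction m using List.reverseRecOn with
  | nil => exact ⟨[], [], .refl _, by simp⟩
  | append_singleton m a ih =>
    obtain ⟨p, q, hpq, hq⟩ := ih
    have hmono {f : E} (hf : AftEvent lab (e :: m) e f) : AftEvent lab (e :: (m ++ [a])) e f :=
      hf.mono (List.sublist_append_left (e :: m) [a])
    by_cases h : ∀ b ∈ e :: q, Indep (lab b) (lab a)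
    · refine ⟨p ++ [a], q, ?_, fun f hf => hmono (hq f hf)⟩
      refine (hpq.append_right [a]).trans _ _ _ ?_
      change MazEquiv lab _ _
      have := (mazEquiv_append_singleton h).append_left p
      simpa using this
    -- The new event `a` is blocked by some `b` that is `e` itself or lies in its causal future; so
    -- `a` belongs to the causal future as well and stays behind.
    · push Not at h
      obtain ⟨b, hb, hd⟩ := h
      refine ⟨p, q ++ [a], by simpa using hpq.append_right [a], fun f hf => ?_⟩
      rcases List.mem_append.1 hf with hf | hf
      · exact hmono (hq f hf)
      · obtain rfl := List.mem_singleton.1 hf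
        have hb' : AftEvent lab (e :: (m ++ [f])) e b := by
          rcases List.mem_cons.1 hb with rfl | hb
          · exact .base
          · exact hmono (hq b hb)
        refine hb'.step ?_ hd
        have hmem : b ∈ e :: m := hpq.perm.symm.subset (List.mem_append_right p hb)
        exact (before_append (s := e :: m)).2 (.inr (.inr ⟨hmem, hf⟩))

/-- Two dependent events `e₁`, `e₂`, in this order, can be made consecutive iff no further event
lies causally between them. -/
theorem mRace_iff {s : List E} {e₁ e₂ : E} (hs : s.Nodup) (hb : Before s e₁ e₂) :
    MRace lab s e₁ e₂ ↔ Conflict (lab e₁) (lab e₂) ∧ (lab e₁).thread ≠ (lab e₂).thread ∧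
      ∀ f, f ≠ e₁ → AftEvent lab s e₁ f → Before s f e₂ → Indep (lab f) (lab e₂) := by
  unfold MRace
  refine and_congr_right fun hc => and_congr_right fun _ => ⟨?_, fun h => ?_⟩
  · rintro ⟨s', heq, u, v, hs'⟩ f hne hf hfe
    by_contra hd
    -- A dependent `f` would still lie between the two events in `s'`, since causal futures and the
    -- order of dependent pairs are invariant; there is no room for it.
    have hn : s'.Nodup := heq.perm.nodup_iff.1 hs
    have h₁ := (heq.before_iff hd).1 hfe
    have h₂ := (heq.before_iff hc.not_indep).1 hb
    have h₃ := ((heq.aftEvent hf).eq_or_before hn).resolve_left hne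
    rcases hs' with rfl | rfl
    · have h₄ := (Before.cases_of_nodup hn).2 h₃
      have hn' : ((u ++ [e₁]) ++ e₂ :: v).Nodup := by simpa using hn
      have h₅ := (Before.cases_of_nodup hn').1 (by simpa using h₁)
      exact (List.nodup_append.1 hn).2.2 f ((List.mem_append.1 h₅).resolve_right
        fun h => hne (List.mem_singleton.1 h)) f (List.mem_cons_of_mem _ h₄) rfl
    · refine h₂.asymm_of_nodup hn ?_
      rw [before_append, before_cons]
      exact .inr (.inl (.inr ⟨rfl, List.mem_cons_self⟩))
  · obtain ⟨u, s₁, rfl⟩ := List.append_of_mem hb.mem.1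
    obtain ⟨m, v, rfl⟩ := List.append_of_mem ((Before.cases_of_nodup hs).2 hb)
    -- The events between `e₁` and `e₂` are split: those in `p` move in front of `e₁`, and those
    -- left in `q` are causally after `e₁`, hence independent of `e₂`, which can jump over them.
    obtain ⟨p, q, hpq, hq⟩ := exists_mazEquiv_cons (lab := lab) e₁ m
    have hn : (e₁ :: m).Nodup := hs.sublist
      ((List.sublist_append_left (e₁ :: m) (e₂ :: v)).trans (List.sublist_append_right u _))
    have hqi : ∀ f ∈ q, Indep (lab f) (lab e₂) := by
      intro f hf
      have hn' : (p ++ e₁ :: q).Nodup := hpq.perm.nodup_iff.1 hn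
      refine h f ?_ ((hq f hf).mono
        ((List.sublist_append_left (e₁ :: m) (e₂ :: v)).trans (List.sublist_append_right u _))) ?_
      · rintro rfl
        exact (List.nodup_cons.1 (List.nodup_append.1 hn').2.1).1 hf
      · have hfm : f ∈ e₁ :: m := hpq.perm.symm.subset (by simp [hf])
        exact before_append.2 (.inr (.inl (before_append (s := e₁ :: m).2
          (.inr (.inr ⟨hfm, List.mem_cons_self⟩)))))
    refine ⟨u ++ (p ++ [e₁] ++ (e₂ :: q)) ++ v, ?_, u ++ p, q ++ v, .inl (by simp)⟩
    have h₁ := (hpq.append_left u).append_right (e₂ :: v)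
    have h₂ := ((mazEquiv_append_singleton hqi).append_left (u ++ (p ++ [e₁]))).append_right v
    simp only [List.append_assoc, List.cons_append, List.nil_append] at h₁ h₂ ⊢
    exact h₁.trans _ _ _ h₂

end

/-! ### Witnesses and summaries expressed by positions and subsequences. -/

section

variable {T X L : Type*}

theorem enabledAfter_iff {σ : List (Label T X L)} {ρ : List (Fin σ.length)} {τ : Subseq σ} :
    EnabledAfter σ ρ τ.1 ↔ (∀ e, e ∈ ρ → ¬ e ∈ τ.1) ∧
      (∀ e, e ∈ ρ ++ τ.1 → ∀ f, ProgOrder σ f e → f ∈ ρ ++ τ.1) ∧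
      WellFormed ((ρ ++ τ.1).map σ.get) ∧
      (∀ e, e ∈ τ.1 → ∀ x : X, (σ.get e).act = .read x →
        (∃ w, ¬ (ReadsFrom σ.get (ρ ++ τ.1) w e ↔ RunReadsFrom σ w e)) →
        ∀ f, f ∈ ρ ++ τ.1 → (σ.get f).thread = (σ.get e).thread → ProgOrder σ f e) := by
  simp only [EnabledAfter, τ.2, true_and, ne_eq, Set.ext_iff, Set.mem_ofPred_eq, not_forall]

theorem seqPSuffix_iff {σ : List (Label T X L)} {ρ : List (Fin σ.length)} {τ : Subseq σ} :
    SeqPSuffix σ ρ τ.1 ↔ EnabledAfter σ ρ τ.1 := by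
  refine and_iff_left fun e he f hf => ?_
  rw [τ.before_iff]
  simp [he, hf]

theorem maximalSeqPSuffix_iff {σ : List (Label T X L)} {ρ : List (Fin σ.length)} {τ : Subseq σ} :
    MaximalSeqPSuffix σ ρ τ.1 ↔ EnabledAfter σ ρ τ.1 ∧ ∀ τ' : Subseq σ, EnabledAfter σ ρ τ'.1 →
      (∀ i, i ∈ τ.1 → i ∈ τ'.1) → ∀ i, i ∈ τ'.1 → i ∈ τ.1 := by
  unfold MaximalSeqPSuffix
  rw [seqPSuffix_iff]
  refine and_congr_right fun _ => ⟨fun h τ' h' hs i hi => ?_, fun h τ' h' hs => ?_⟩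
  · rwa [← h τ'.1 (seqPSuffix_iff.2 h') (Subseq.sublist_iff.2 hs)]
  · have := h ⟨τ', h'.1.1⟩ h'.1 fun i hi => hs.subset hi
    exact congrArg Subtype.val (Subseq.ext (s := ⟨τ', h'.1.1⟩) fun i =>
      ⟨this i, fun hi => hs.subset hi⟩)

/-- A subsequence of an increasing list is a prefix exactly if it is downward closed; over all
threads together this is closure under program order. -/
theorem projThread_prefix_iff {σ : List (Label T X L)} {ρ : Subseq σ} :
    (∀ t, projThread σ ρ.1 t <+: projThread σ (List.finRange σ.length) t) ↔
      ∀ e, e ∈ ρ.1 → ∀ f, ProgOrder σ f e → f ∈ ρ.1 := by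
  classical
  have key (t : T) : projThread σ ρ.1 t <+: projThread σ (List.finRange σ.length) t ↔ _ :=
    Subseq.prefix_iff (s := ⟨projThread σ ρ.1 t, List.filter_sublist.trans ρ.2⟩)
      (t := ⟨projThread σ (List.finRange σ.length) t, List.filter_sublist⟩)
  rw [forall_congr' key]
  simp only [projThread, List.mem_filter, List.mem_finRange, true_and, decide_eq_true_eq]
  constructor
  · rintro h e he f ⟨ht, hle⟩
    rcases hle.lt_or_eq with hlt | rfl
    · exact ((h (σ.get e).thread).2 e ⟨he, rfl⟩ f ht hlt).1
    · exact he
  · exact fun h t => ⟨fun i hi => hi.2, fun a ha b hb hlt =>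
      ⟨h a ha.1 b ⟨hb.trans ha.2.symm, hlt.le⟩, hb⟩⟩

theorem seqPPrefix_iff {σ : List (Label T X L)} {ρ : Subseq σ} :
    SeqPPrefix σ ρ.1 ↔ WellFormed (ρ.1.map σ.get) ∧
      (∀ e, e ∈ ρ.1 → ∀ f, ProgOrder σ f e → f ∈ ρ.1) ∧
      ∀ w r, ReadsFrom σ.get ρ.1 w r → RunReadsFrom σ w r := by
  unfold SeqPPrefix CorrectReordering
  rw [projThread_prefix_iff, and_iff_left, and_iff_right (ρ.2.nodup (List.nodup_finRange _))]
  intro e he f hf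
  rw [ρ.before_iff]
  simp [he, hf]

/-- The prefix of a guess is an arbitrary list; this lets the quantifier over it range over `Subseq`
without loss. -/
theorem SeqPPrefix.sublist {σ : List (Label T X L)} {ρ : List (Fin σ.length)}
    (h : SeqPPrefix σ ρ) : ρ.Sublist (List.finRange σ.length) := by
  refine sublist_finRange_of_pairwise (List.pairwise_iff_forall_sublist.2 fun {a b} hab => ?_)
  exact (h.2 a (hab.subset (by simp)) b (hab.subset (by simp))).1 hab

theorem aftEvent_iff {σ : List (Label T X L)} {s : List (Fin σ.length)} {e₁ e : Fin σ.length} :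
    AftEvent σ.get s e₁ e ↔ ∀ Z : Subseq σ, e₁ ∈ Z.1 → (∀ f, f ∈ Z.1 → ∀ g, Before s f g →
      ¬ Indep (σ.get f) (σ.get g) → g ∈ Z.1) → e ∈ Z.1 := by
  constructor
  · intro h Z h₁ h₂
    induction h with
    | base => exact h₁
    | step _ hb hd ih => exact h₂ _ ih _ hb hd
  · intro h
    -- The causal future is itself one of the closed sets `Z`.
    have := h (subseq (AftEvent σ.get s e₁))
    simp only [mem_subseq] at this
    exact this .base fun f hf g hb hd => hf.step hb hd

/-- Allows the concatenation of the grains to be a variable `τ` of its own, tied to the grains by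
membership and order alone. -/
theorem Subseq.eq_append_iff {σ : List (Label T X L)} {τ s t : Subseq σ} :
    τ.1 = s.1 ++ t.1 ↔ (∀ i, i ∈ τ.1 ↔ i ∈ s.1 ++ t.1) ∧ ∀ a, a ∈ s.1 → ∀ b, b ∈ t.1 → a < b := by
  constructor
  · intro h
    refine ⟨fun i => by rw [h], ?_⟩
    have := τ.pairwise
    rw [h, List.pairwise_append] at this
    exact this.2.2
  · rintro ⟨h₁, h₂⟩
    exact τ.eq_of_pairwise (List.pairwise_append.2 ⟨s.pairwise, t.pairwise, h₂⟩) h₁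

/-- Witnesses given by subsequences `ρ`, `g₁`, `g₂`, where `τ` is the concatenation of the grains,
in a form that involves only the order of `σ`. -/
def SubseqWitness (σ : List (Label T X L)) (ρ g₁ g₂ τ : Subseq σ) (e₁ e₂ : Fin σ.length) : Prop :=
  ((∀ i, i ∈ τ.1 ↔ i ∈ g₁.1 ++ g₂.1) ∧ ∀ a, a ∈ g₁.1 → ∀ b, b ∈ g₂.1 → a < b) ∧
  SeqPPrefix σ ρ.1 ∧
  (∃ τ₁ τ₂ : Subseq σ, MaximalSeqPSuffix σ ρ.1 τ₁.1 ∧ MaximalSeqPSuffix σ ρ.1 τ₂.1 ∧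
    g₁.1 <:+: τ₁.1 ∧ g₂.1 <:+: τ₂.1) ∧
  e₁ ∈ g₁.1 ∧ e₂ ∈ g₂.1 ∧ EnabledAfter σ ρ.1 τ.1 ∧
  Conflict (σ.get e₁) (σ.get e₂) ∧ ¬ (σ.get e₁).thread = (σ.get e₂).thread ∧
  ∀ f, f ≠ e₁ → AftEvent σ.get τ.1 e₁ f → Before τ.1 f e₂ → Indep (σ.get f) (σ.get e₂)

theorem subseqWitness_iff {σ : List (Label T X L)} {ρ g₁ g₂ τ : Subseq σ} {e₁ e₂ : Fin σ.length} :
    SubseqWitness σ ρ g₁ g₂ τ e₁ e₂ ↔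
      τ.1 = g₁.1 ++ g₂.1 ∧ IsWitness σ ⟨ρ.1, g₁.1, g₂.1, e₁, e₂⟩ := by
  unfold SubseqWitness IsWitness
  rw [← Subseq.eq_append_iff]
  refine and_congr_right fun hτ => and_congr_right fun _ => and_congr ?_ ?_
  · constructor
    · rintro ⟨τ₁, τ₂, h⟩
      exact ⟨τ₁.1, τ₂.1, h⟩
    · rintro ⟨τ₁, τ₂, h₁, h₂, h⟩
      exact ⟨⟨τ₁, h₁.1.1.1⟩, ⟨τ₂, h₂.1.1.1⟩, h₁, h₂, h⟩
  · refine and_congr_right fun h₁ => and_congr_right fun h₂ => ?_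
    dsimp only at h₁ h₂ ⊢
    -- The criterion needs `e₁` before `e₂`; this holds because they lie in the first and the second
    -- grain.
    rw [← hτ, mRace_iff (τ.2.nodup (List.nodup_finRange _))]
    rw [hτ]
    exact before_append.2 (.inr (.inr ⟨h₁, h₂⟩))

theorem IsWitness.exists_subseq {σ : List (Label T X L)} {W : Guess σ.length}
    (h : IsWitness σ W) : ∃ ρ g₁ g₂ τ : Subseq σ, W = ⟨ρ.1, g₁.1, g₂.1, W.e₁, W.e₂⟩ ∧
      SubseqWitness σ ρ g₁ g₂ τ W.e₁ W.e₂ := by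
  have hτ := h.2.2.2.2.1.1
  exact ⟨⟨W.pre, h.1.sublist⟩, ⟨W.g₁, (List.sublist_append_left _ _).trans hτ⟩,
    ⟨W.g₂, (List.sublist_append_right _ _).trans hτ⟩, ⟨W.g₁ ++ W.g₂, hτ⟩, rfl,
    subseqWitness_iff.2 ⟨rfl, h⟩⟩

/-- The state `c` is the summary of a guess, given by subsequences, after reading position `p`. -/
def IsSummary (σ : List (Label T X L)) (c : GrState T X L) (ρ g₁ g₂ τ : Subseq σ)
    (e₁ e₂ p : Fin σ.length) : Prop :=
  ((e₁.val < p.val + 1 → some (σ.get e₁) = c.e₁) ∧ (¬ e₁.val < p.val + 1 → none = c.e₁)) ∧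
  prefixSummary σ ρ.1 (p.val + 1) = c.pre ∧ grainSummary σ g₁.1 (p.val + 1) = c.g₁ ∧
  grainSummary σ g₂.1 (p.val + 1) = c.g₂ ∧ depSet σ τ.1 e₁ (p.val + 1) = c.aft ∧
  phaseAt ⟨ρ.1, g₁.1, g₂.1, e₁, e₂⟩ (p.val + 1) = c.phase

theorem isSummary_iff {σ : List (Label T X L)} {c : GrState T X L} {ρ g₁ g₂ τ : Subseq σ}
    {e₁ e₂ p : Fin σ.length} (hτ : τ.1 = g₁.1 ++ g₂.1) :
    IsSummary σ c ρ g₁ g₂ τ e₁ e₂ p ↔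
      summaryAt σ ⟨ρ.1, g₁.1, g₂.1, e₁, e₂⟩ (p.val + 1) = c := by
  obtain ⟨c₁, c₂, c₃, c₄, c₅, c₆⟩ := c
  simp only [IsSummary, summaryAt, GrState.mk.injEq, ite_eq_iff', hτ]

end

/-! ### Definability of witnesses and of single summaries. -/

section

variable {T X L : Type*} [Finite T] [Finite X] [Finite L] {Γ : List (Label T X L) → Type} [Coded Γ]
  (x y z : ∀ σ, Γ σ → Fin σ.length) [IsLocal x] [IsLocal y] [IsLocal z]
  (s t : ∀ σ, Γ σ → Subseq σ) [IsLocal s] [IsLocal t]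

/-- Reduced to the version for concatenations by appending the empty subsequence. -/
instance Definable.readsFrom_subseq :
    Definable fun σ γ => ReadsFrom σ.get (s σ γ).1 (x σ γ) (y σ γ) :=
  .congr (Q := fun σ γ => ReadsFrom σ.get ((s σ γ).1 ++ (⟨[], List.nil_sublist _⟩ : Subseq σ).1)
    (x σ γ) (y σ γ)) fun σ γ => by rw [List.append_nil]

instance Definable.runReadsFrom : Definable fun σ γ => RunReadsFrom σ (x σ γ) (y σ γ) :=
  Definable.readsFrom_subseq x y fun σ _ => ⟨List.finRange σ.length, List.Sublist.refl _⟩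

instance Definable.wellFormed_append :
    Definable fun σ γ => WellFormed (((s σ γ).1 ++ (t σ γ).1).map σ.get) :=
  .append_mem isRegular_wellFormed s t

instance Definable.wellFormed_subseq : Definable fun σ γ => WellFormed ((s σ γ).1.map σ.get) :=
  .congr (Q := fun σ γ => WellFormed
    (((s σ γ).1 ++ (⟨[], List.nil_sublist _⟩ : Subseq σ).1).map σ.get))
    fun σ γ => by rw [List.append_nil]

instance Definable.wellFormed : Definable fun σ (_ : Γ σ) => WellFormed σ :=
  .congr (Q := fun σ γ => WellFormed
    ((⟨List.finRange σ.length, List.Sublist.refl _⟩ : Subseq σ).1.map σ.get))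
    fun σ γ => by simp

instance Definable.enabledAfter : Definable fun σ γ => EnabledAfter σ (s σ γ).1 (t σ γ).1 :=
  have : Definable fun σ (p : Subseq σ × Subseq σ) => EnabledAfter σ p.1.1 p.2.1 := by
    simp only [enabledAfter_iff]; infer_instance
  this.comp _ fun σ γ => (s σ γ, t σ γ)

instance Definable.maximalSeqPSuffix :
    Definable fun σ γ => MaximalSeqPSuffix σ (s σ γ).1 (t σ γ).1 :=
  have : Definable fun σ (p : Subseq σ × Subseq σ) => MaximalSeqPSuffix σ p.1.1 p.2.1 := by
    simp only [maximalSeqPSuffix_iff]; infer_instance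
  this.comp _ fun σ γ => (s σ γ, t σ γ)

instance Definable.seqPPrefix : Definable fun σ γ => SeqPPrefix σ (s σ γ).1 :=
  have : Definable fun σ (p : Subseq σ) => SeqPPrefix σ p.1 := by
    simp only [seqPPrefix_iff]; infer_instance
  this.comp _ fun σ γ => s σ γ

instance Definable.aftEvent :
    Definable fun σ γ => AftEvent σ.get (s σ γ).1 (x σ γ) (y σ γ) :=
  have : Definable fun σ (p : Subseq σ × Fin σ.length × Fin σ.length) =>
      AftEvent σ.get p.1.1 p.2.1 p.2.2 := by
    simp only [aftEvent_iff]; infer_instance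
  this.comp _ fun σ γ => (s σ γ, x σ γ, y σ γ)

instance Definable.isInfix : Definable fun σ γ => (s σ γ).1 <:+: (t σ γ).1 :=
  have : Definable fun (σ : List (Label T X L)) (p : Subseq σ × Subseq σ) => p.1.1 <:+: p.2.1 := by
    simp only [Subseq.infix_iff]; infer_instance
  this.comp _ fun σ γ => (s σ γ, t σ γ)

instance Definable.matching (l : L) : Definable fun σ γ => Matching σ l (x σ γ) (y σ γ) :=
  have : Definable fun σ (p : Fin σ.length × Fin σ.length) => Matching σ l p.1 p.2 := by
    unfold Matching; infer_instance
  this.comp _ fun σ γ => (x σ γ, y σ γ)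

instance Definable.prefixSummary_eq (c : PrefixSummary T X L) :
    Definable fun σ γ => prefixSummary σ (s σ γ).1 ((x σ γ).val + 1) = c :=
  have : Definable fun σ (p : Subseq σ × Fin σ.length) =>
      prefixSummary σ p.1.1 (p.2.val + 1) = c := by
    obtain ⟨c₁, c₂, c₃⟩ := c
    simp only [prefixSummary, PrefixSummary.mk.injEq, Set.ext_iff, Set.mem_ofPred_eq]
    infer_instance
  this.comp _ fun σ γ => (s σ γ, x σ γ)

instance Definable.grainSummary_eq (c : GrainSummary T X L) :
    Definable fun σ γ => grainSummary σ (s σ γ).1 ((x σ γ).val + 1) = c :=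
  have : Definable fun σ (p : Subseq σ × Fin σ.length) =>
      grainSummary σ p.1.1 (p.2.val + 1) = c := by
    obtain ⟨c₁, c₂, c₃, c₄, c₅⟩ := c
    simp only [grainSummary, GrainSummary.mk.injEq, Set.ext_iff, Set.mem_ofPred_eq]
    infer_instance
  this.comp _ fun σ γ => (s σ γ, x σ γ)

instance Definable.depSet_eq (c : DepSet T X L) :
    Definable fun σ γ => depSet σ (s σ γ).1 (x σ γ) ((y σ γ).val + 1) = c :=
  have : Definable fun σ (p : Subseq σ × Fin σ.length × Fin σ.length) =>
      depSet σ p.1.1 p.2.1 (p.2.2.val + 1) = c := by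
    obtain ⟨c₁, c₂, c₃, c₄⟩ := c
    simp only [depSet, DepSet.mk.injEq, Set.ext_iff, Set.mem_ofPred_eq]
    infer_instance
  this.comp _ fun σ γ => (s σ γ, x σ γ, y σ γ)

variable (g₁ g₂ τ : ∀ σ, Γ σ → Subseq σ) [IsLocal g₁] [IsLocal g₂] [IsLocal τ]

instance Definable.phaseAt_eq (c : Phase) : Definable fun σ γ =>
    phaseAt ⟨(s σ γ).1, (g₁ σ γ).1, (g₂ σ γ).1, x σ γ, y σ γ⟩ ((z σ γ).val + 1) = c :=
  have : Definable fun (σ : List (Label T X L))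
      (p : Subseq σ × Subseq σ × Subseq σ × Fin σ.length × Fin σ.length × Fin σ.length) =>
      phaseAt ⟨p.1.1, p.2.1.1, p.2.2.1.1, p.2.2.2.1, p.2.2.2.2.1⟩ (p.2.2.2.2.2.val + 1) = c := by
    simp only [phaseAt, ite_eq_iff']
    infer_instance
  this.comp _ fun σ γ => (s σ γ, g₁ σ γ, g₂ σ γ, x σ γ, y σ γ, z σ γ)

instance Definable.isSummary (c : GrState T X L) : Definable fun σ γ =>
    IsSummary σ c (s σ γ) (g₁ σ γ) (g₂ σ γ) (τ σ γ) (x σ γ) (y σ γ) (z σ γ) := by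
  unfold IsSummary; infer_instance

instance Definable.subseqWitness : Definable fun σ γ =>
    SubseqWitness σ (s σ γ) (g₁ σ γ) (g₂ σ γ) (τ σ γ) (x σ γ) (y σ γ) :=
  have : Definable fun (σ : List (Label T X L))
      (p : Subseq σ × Subseq σ × Subseq σ × Subseq σ × Fin σ.length × Fin σ.length) =>
      SubseqWitness σ p.1 p.2.1 p.2.2.1 p.2.2.2.1 p.2.2.2.2.1 p.2.2.2.2.2 := by
    unfold SubseqWitness; infer_instance
  this.comp _ fun σ γ => (s σ γ, g₁ σ γ, g₂ σ γ, τ σ γ, x σ γ, y σ γ)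

end

/-! ### Definability of the decorations by summaries. -/

section

variable {T X L : Type*} [Finite T] [Finite X] [Finite L]

instance Definable.isSummary_imp_eq {Γ : List (Label T X L) → Type} [Coded Γ]
    (x y z : ∀ σ, Γ σ → Fin σ.length) [IsLocal x] [IsLocal y] [IsLocal z]
    (s g₁ g₂ τ : ∀ σ, Γ σ → Subseq σ) [IsLocal s] [IsLocal g₁] [IsLocal g₂] [IsLocal τ]
    [Finite (GrState T X L)] {N : ℕ} (d : ∀ σ, Γ σ → Fin σ.length → Fin N) [IsLocal d]
    (idx : GrState T X L → Fin N) : Definable fun σ γ =>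
    ∀ c, IsSummary σ c (s σ γ) (g₁ σ γ) (g₂ σ γ) (τ σ γ) (x σ γ) (y σ γ) (z σ γ) →
      d σ γ (z σ γ) = idx c :=
  have (c : GrState T X L) : Definable fun σ γ =>
      IsSummary σ c (s σ γ) (g₁ σ γ) (g₂ σ γ) (τ σ γ) (x σ γ) (y σ γ) (z σ γ) →
        d σ γ (z σ γ) = idx c := inferInstance
  .finite_forall _

/-- The decorations of well-formed runs by the numbers of the summaries of a witness. -/
theorem Definable.summaries {N : ℕ} (idx : GrState T X L → Fin N) [Finite (GrState T X L)] :
    Definable fun σ (d : Fin σ.length → Fin N) => WellFormed σ ∧ ∃ W : Guess σ.length,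
      IsWitness σ W ∧ ∀ p : Fin σ.length, d p = idx (summaryAt σ W (p.val + 1)) := by
  -- The equation between `d p` and the number of the summary becomes a conjunction over the
  -- finitely many tuples `c`: for a fixed `c`, "the summary is `c`" is definable and `idx c` is a
  -- constant.
  refine .congr (Q := fun σ d => WellFormed σ ∧ ∃ ρ g₁ g₂ τ : Subseq σ, ∃ e₁ e₂ : Fin σ.length,
    SubseqWitness σ ρ g₁ g₂ τ e₁ e₂ ∧
      ∀ p : Fin σ.length, ∀ c, IsSummary σ c ρ g₁ g₂ τ e₁ e₂ p → d p = idx c) fun σ d => ?_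
  refine and_congr_right fun _ => ⟨?_, ?_⟩
  · rintro ⟨W, hW, hd⟩
    obtain ⟨ρ, g₁, g₂, τ, e, h⟩ := hW.exists_subseq
    refine ⟨ρ, g₁, g₂, τ, _, _, h, fun p c hc => ?_⟩
    rw [isSummary_iff (subseqWitness_iff.1 h).1, ← e] at hc
    rw [hd, hc]
  · rintro ⟨ρ, g₁, g₂, τ, e₁, e₂, h, hd⟩
    obtain ⟨hτ, hW⟩ := subseqWitness_iff.1 h
    exact ⟨_, hW, fun p => hd p _ ((isSummary_iff hτ).2 rfl)⟩

end

/-! ### Finiteness of the state tuples and the initial summary. -/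

section

variable {T X L : Type*}

instance [Finite X] [Finite T] [Finite L] : Finite (GrState T X L) := by
  have : Finite (PrefixSummary T X L) :=
    Finite.of_injective (fun p => (p.exclThreads, p.openLcks, p.exclLastWrs)) fun p q h => by
      cases p; cases q; simp_all
  have : Finite (GrainSummary T X L) :=
    Finite.of_injective
      (fun p => (p.inclThreads, p.inclAcqs, p.orphanRels, p.inclWrs, p.orphanRds)) fun p q h => by
      cases p; cases q; simp_all
  have : Finite (DepSet T X L) :=
    Finite.of_injective (fun p => (p.threads, p.reads, p.writes, p.locks)) fun p q h => by
      cases p; cases q; simp_all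
  have : Finite Phase :=
    Finite.of_surjective ![Phase.before, .inside₁, .between, .inside₂] fun p => by
      cases p
      exacts [⟨0, rfl⟩, ⟨1, rfl⟩, ⟨2, rfl⟩, ⟨3, rfl⟩]
  exact Finite.of_injective (fun p => (p.e₁, p.pre, p.g₁, p.g₂, p.aft, p.phase)) fun p q h => by
    cases p; cases q; simp_all

/-- The summary before the first event. -/
def initialSummary : GrState T X L where
  e₁ := none
  pre := ⟨∅, ∅, ∅⟩
  g₁ := ⟨∅, ∅, ∅, ∅, ∅⟩
  g₂ := ⟨∅, ∅, ∅, ∅, ∅⟩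
  aft := ⟨∅, ∅, ∅, ∅⟩
  phase := .before

theorem summaryAt_zero (σ : List (Label T X L)) (W : Guess σ.length) :
    summaryAt σ W 0 = initialSummary := by
  simp [summaryAt, initialSummary, prefixSummary, grainSummary, depSet, phaseAt]

end

/-! ### Automata that guess decorations, and streaming programs. -/

section

variable {α S Q : Type*} {N : ℕ}

theorem mem_evalFrom_iff_exists_run (A : NFA α S) (w : List α) (S₀ : Set S) (s : S) :
    s ∈ A.evalFrom S₀ w ↔ ∃ q : ℕ → S, q 0 ∈ S₀ ∧
      (∀ i : Fin w.length, q (i.val + 1) ∈ A.step (q i.val) (w.get i)) ∧ q w.length = s := by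
  induction w generalizing S₀ with
  | nil =>
    constructor
    · intro h
      exact ⟨fun _ => s, h, fun i => i.elim0, rfl⟩
    · rintro ⟨q, h, -, rfl⟩
      exact h
  | cons a w ih =>
    rw [NFA.evalFrom_cons, ih]
    constructor
    · rintro ⟨q, h₀, h, rfl⟩
      obtain ⟨s₀, hs₀, h₀⟩ := A.mem_stepSet.1 h₀
      refine ⟨fun k => k.casesOn s₀ q, hs₀, fun i => ?_, rfl⟩
      refine Fin.cases h₀ (fun i => ?_) i
      exact h i
    · rintro ⟨q, h₀, h, rfl⟩
      exact ⟨fun k => q (k + 1), A.mem_stepSet.2 ⟨q 0, h₀, h ⟨0, Nat.succ_pos _⟩⟩,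
        fun i => h i.succ, rfl⟩

theorem mem_accepts_iff_exists_acceptingRun (A : NFA α S) (w : List α) :
    w ∈ A.accepts ↔ ∃ q, AcceptingRun A w q := by
  rw [NFA.mem_accepts]
  simp only [mem_evalFrom_iff_exists_run, AcceptingRun]
  constructor
  · rintro ⟨s, hs, q, h₀, h, rfl⟩
    exact ⟨q, h₀, h, hs⟩
  · rintro ⟨q, h₀, h, hs⟩
    exact ⟨_, hs, q, h₀, h, rfl⟩

/-- The automaton that guesses a decoration of its input by elements of `S`, which it shows in the
first component of its state, and runs `D` on the decorated word. -/
def guessNFA (D : DFA (α × Fin N) Q) (e : S → Fin N) (s₀ : S) : NFA α (S × Q) where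
  step q a := {q' | q'.2 = D.step q.2 (a, e q'.1)}
  start := {(s₀, D.start)}
  accept := {q | q.2 ∈ D.accept}

theorem eval_take_succ (D : DFA α Q) (l : List α) (k : ℕ) (hk : k < l.length) :
    D.eval (l.take (k + 1)) = D.step (D.eval (l.take k)) l[k] := by
  rw [← List.take_append_getElem hk, DFA.eval_append_singleton]

/-- Once the shown components are fixed, the second component is forced: it is the state of `D` on
the decorated word read so far. Letter `i` carries `s (i + 1)`, the value after reading it; `s 0`
decorates no letter and is therefore prescribed by the start state. -/
theorem acceptingRun_guessNFA (D : DFA (α × Fin N) Q) (e : S → Fin N) (s₀ : S) (w : List α)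
    (s : ℕ → S) : (∃ q, AcceptingRun (guessNFA D e s₀) w q ∧ ∀ k ≤ w.length, (q k).1 = s k) ↔
      s 0 = s₀ ∧ List.ofFn (fun i : Fin w.length => (w.get i, e (s (i.val + 1)))) ∈ D.accepts := by
  set l := List.ofFn (fun i : Fin w.length => (w.get i, e (s (i.val + 1)))) with hl
  have hlen : l.length = w.length := by simp [hl]
  have hget (k : ℕ) (hk : k < w.length) : l[k]'(hlen ▸ hk) = (w.get ⟨k, hk⟩, e (s (k + 1))) := by
    simp [hl]
  constructor
  · rintro ⟨q, ⟨h₀, h, hacc⟩, hs⟩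
    have h₀ : q 0 = (s₀, D.start) := h₀
    have key (k : ℕ) (hk : k ≤ w.length) : (q k).2 = D.eval (l.take k) := by
      induction k with
      | zero => simp [h₀]
      | succ k ih =>
        have h₁ : (q (k + 1)).2 = D.step (q k).2 (w.get ⟨k, hk⟩, e (q (k + 1)).1) := h ⟨k, hk⟩
        rw [eval_take_succ D l k (hlen ▸ hk), hget k hk, ← ih (Nat.le_of_succ_le hk), h₁, hs _ hk]
    refine ⟨by rw [← hs 0 (Nat.zero_le _), h₀], ?_⟩
    have hacc : (q w.length).2 ∈ D.accept := hacc
    rwa [key _ le_rfl, ← hlen, List.take_length] at hacc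
  · rintro ⟨h₀, hacc⟩
    refine ⟨fun k => (s k, D.eval (l.take k)), ⟨?_, fun i => ?_, ?_⟩, fun _ _ => rfl⟩
    · exact Prod.ext h₀ (by simp)
    · change D.eval _ = _
      rw [eval_take_succ D l i (i.2.trans_eq hlen.symm), hget i i.2]
    · change D.eval _ ∈ D.accept
      rw [← hlen, List.take_length]
      exact hacc

open Classical in
/-- Regular languages are decided by one-pass programs that make one step for each letter. -/
theorem exists_streamProg {K : Language α} (hK : K.IsRegular) :
    ∃ P : StreamProg α, ∀ w : List α, P.HaltsWithin w (w.length + 1) (decide (w ∈ K)) := by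
  obtain ⟨Q, _, M, rfl⟩ := hK
  let e : Q ⊕ Bool ≃ Fin (Fintype.card (Q ⊕ Bool)) := Fintype.equivFin _
  -- The state of the DFA is the program counter, so no memory bits are needed; two further lines
  -- halt with the two answers. One fetch per letter and one at the end of input give `w.length + 1`
  -- steps.
  let P : StreamProg α :=
    { lines := Fintype.card (Q ⊕ Bool)
      bits := 0
      code := fun n => match e.symm n with
        | .inl q => .fetch fun
          | none => e (.inr (decide (q ∈ M.accept)))
          | some a => e (.inl (M.step q a))
        | .inr b => .halt b
      entry := e (.inl M.start) }
  have key (w : List α) (q : Q) (mem : Fin 0 → Bool) :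
      (P.step^[w.length + 1] ⟨e (.inl q), mem, w⟩).pc =
        e (.inr (decide (M.evalFrom q w ∈ M.accept))) := by
    induction w generalizing q with
    | nil =>
      simp [StreamProg.step, P]
      exact decide_eq_decide.2 Iff.rfl
    | cons a w ih =>
      rw [List.length_cons, Function.iterate_succ_apply]
      have : P.step ⟨e (.inl q), mem, a :: w⟩ = ⟨e (.inl (M.step q a)), mem, w⟩ := by
        simp [StreamProg.step, P]
      rw [this, ih, DFA.evalFrom_cons]
  refine ⟨P, fun w => ?_⟩
  unfold StreamProg.HaltsWithin
  change P.code (P.step^[w.length + 1] ⟨e (.inl M.start), _, w⟩).pc = _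
  rw [key]
  simp [P]
  rfl

end

/-- There is an automaton whose accepting runs show exactly the summaries of the witnesses. -/
theorem exists_summaryNFA (T X L : Type*) [Finite T] [Finite X] [Finite L] :
    ∃ (M : Type) (A : NFA (Label T X L) (GrState T X L × M)), Finite (GrState T X L × M) ∧
      A.accepts = grPrefixLang T X L ∧
      (∀ σ : List (Label T X L), WellFormed σ → ∀ W : Guess σ.length, IsWitness σ W →
        ∃ q, AcceptingRun A σ q ∧ ∀ k ≤ σ.length, (q k).1 = summaryAt σ W k) ∧
      (∀ (σ : List (Label T X L)) (q : ℕ → GrState T X L × M), AcceptingRun A σ q →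
        ∃ W : Guess σ.length, IsWitness σ W ∧ ∀ k ≤ σ.length, (q k).1 = summaryAt σ W k) := by
  -- Codes live in `Type`, whereas the tuples live in the universes of `T`, `X`, `L`; hence
  -- decorations use numbers of tuples.
  obtain ⟨N, ⟨idx⟩⟩ := Finite.exists_equiv_fin (GrState T X L)
  obtain ⟨Q, _, D, hD⟩ := (Definable.summaries (T := T) (X := X) (L := L) idx).regular
  have hmem (σ : List (Label T X L)) (d : Fin σ.length → Fin N) :
      List.ofFn (fun i => (σ.get i, d i)) ∈ D.accepts ↔ WellFormed σ ∧ ∃ W : Guess σ.length,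
        IsWitness σ W ∧ ∀ p : Fin σ.length, d p = idx (summaryAt σ W (p.val + 1)) := by
    rw [hD]
    exact enc_mem_lang (Γ := fun σ : List (Label T X L) => Fin σ.length → Fin N) (γ := d)
  let A := guessNFA D idx initialSummary
  have h₁ : ∀ σ : List (Label T X L), WellFormed σ → ∀ W : Guess σ.length, IsWitness σ W →
      ∃ q, AcceptingRun A σ q ∧ ∀ k ≤ σ.length, (q k).1 = summaryAt σ W k := by
    intro σ hσ W hW
    exact (acceptingRun_guessNFA D idx initialSummary σ _).2
      ⟨summaryAt_zero σ W, (hmem σ _).2 ⟨hσ, W, hW, fun p => rfl⟩⟩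
  have h₂ : ∀ (σ : List (Label T X L)) (q : ℕ → GrState T X L × Q), AcceptingRun A σ q →
      WellFormed σ ∧ ∃ W : Guess σ.length, IsWitness σ W ∧
        ∀ k ≤ σ.length, (q k).1 = summaryAt σ W k := by
    intro σ q hq
    obtain ⟨h₀, h⟩ := (acceptingRun_guessNFA D idx initialSummary σ fun k => (q k).1).1
      ⟨q, hq, fun _ _ => rfl⟩
    obtain ⟨hσ, W, hW, hd⟩ := (hmem σ _).1 h
    refine ⟨hσ, W, hW, fun k hk => ?_⟩
    -- The summary at `0` is the same for all witnesses; the later ones are recovered from their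
    -- numbers by injectivity of `idx`.
    rcases k with _ | k
    · rw [h₀, summaryAt_zero]
    · exact idx.injective (hd ⟨k, hk⟩)
  refine ⟨Q, A, inferInstance, Language.ext fun σ => ?_, h₁, fun σ q hq => (h₂ σ q hq).2⟩
  rw [mem_accepts_iff_exists_acceptingRun]
  constructor
  · rintro ⟨q, hq⟩
    obtain ⟨hσ, W, hW, -⟩ := h₂ σ q hq
    exact ⟨hσ, W.e₁, W.e₂, W, rfl, rfl, hW⟩
  · rintro ⟨hσ, _, _, W, -, -, hW⟩
    exact (h₁ σ hσ W hW).imp fun q hq => hq.1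

theorem isRegular_grPrefixLang (T X L : Type*) [Finite T] [Finite X] [Finite L] :
    (grPrefixLang T X L).IsRegular := by
  obtain ⟨M, A, hfin, hA, -⟩ := exists_summaryNFA T X L
  exact Language.isRegular_iff.2 ⟨_, Fintype.ofFinite _, A.toDFA, A.toDFA_correct.trans hA⟩

end RacePrediction

open Classical in
theorem mainTheorem4 (T X L : Type*) [Finite T] [Finite X] [Finite L] :
    (∃ (M : Type) (A : NFA (RacePrediction.Label T X L) (RacePrediction.GrState T X L × M)),
      Finite (RacePrediction.GrState T X L × M) ∧
      A.accepts = RacePrediction.grPrefixLang T X L ∧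
      (∀ σ : List (RacePrediction.Label T X L), RacePrediction.WellFormed σ →
        ∀ W : RacePrediction.Guess σ.length, RacePrediction.IsWitness σ W →
          ∃ q, RacePrediction.AcceptingRun A σ q ∧
            ∀ k ≤ σ.length, (q k).1 = RacePrediction.summaryAt σ W k) ∧
      (∀ (σ : List (RacePrediction.Label T X L)) (q : ℕ → RacePrediction.GrState T X L × M),
        RacePrediction.AcceptingRun A σ q →
          ∃ W : RacePrediction.Guess σ.length, RacePrediction.IsWitness σ W ∧
            ∀ k ≤ σ.length, (q k).1 = RacePrediction.summaryAt σ W k)) ∧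
    (∃ (P : RacePrediction.StreamProg (RacePrediction.Label T X L)) (c : ℕ),
      ∀ σ : List (RacePrediction.Label T X L),
        P.HaltsWithin σ (c * (σ.length + 1))
          (decide (σ ∈ RacePrediction.grPrefixLang T X L))) := by
  refine ⟨RacePrediction.exists_summaryNFA T X L, ?_⟩
  obtain ⟨P, hP⟩ := RacePrediction.exists_streamProg (RacePrediction.isRegular_grPrefixLang T X L)
  exact ⟨P, 1, fun σ => by rw [one_mul]; exact hP σ⟩
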